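/- Let $n\in\mathbb N$, $1<p<n$, $1\le\beta<n/p$, $0\le\gamma\le n$, and let $q$ be given by $\frac1q=\frac1p-\frac{\beta-1}{n}$. Let $\Omega\subset\mathbb R^n$ be an open set (in particular, any domain) with $|\Omega|<\infty$. Put $\varphi(t)=(1+t)^\gamma$, and for $f:\Omega\to\mathbb R$ and $x\in\Omega$ let $$M_{\varphi,\beta,\Omega}f(x)=\sup_{0<r<\operatorname{dist}(x,\mathbb R^n\setminus\Omega)}\frac{r^{\beta}(1+r^{n})^{\gamma\beta/n}}{\varphi(|B(x,r)|)\,|B(x,r)|}\int_{B(x,r)}|f(y)|\,dy .$$ For $1\le s<\infty$ let $W^{1,s}(\Omega)$ be the space of all $f\in L^s(\Omega)$ with a weak gradient $\nabla f\in L^s(\Omega)$, with the norm $\|f\|_{W^{1,s}(\Omega)}=\|f\|_{L^s(\Omega)}+\|\nabla f\|_{L^s(\Omega)}$. Then there is a constant $C>0$, independent of $f$, such that for every $f\in W^{1,p}(\Omega)$ the function $M_{\varphi,\beta,\Omega}f$ is finite almost everywhere in $\Omega$, belongs to $W^{1,q}(\Omega)$, and satisfies $$\|M_{\varphi,\beta,\Omega}f\|_{W^{1,q}(\Omega)}\le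 C\,\|f\|_{W^{1,p}(\Omega)} .$$ -/

import Mathlib

open MeasureTheory
open scoped ENNReal NNReal ContDiff

/-- `g` is a weak gradient of `f` on the open set `Ω ⊆ ℝⁿ`: both are locally integrable on `Ω`, and
`∫_Ω f ∂ᵢψ = - ∫_Ω gᵢ ψ` for every coordinate `i` and every `ψ ∈ C_c^∞(Ω)`. Functions on `Ω` are
represented by functions on `ℝⁿ`, whose values outside `Ω` play no role. -/
structure HasWeakGradient {n : ℕ} (Ω : Set (EuclideanSpace ℝ (Fin n)))
    (f : EuclideanSpace ℝ (Fin n) → ℝ)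
    (g : EuclideanSpace ℝ (Fin n) → EuclideanSpace ℝ (Fin n)) : Prop where
  locallyIntegrableOn : LocallyIntegrableOn f Ω volume
  locallyIntegrableOn_grad : LocallyIntegrableOn g Ω volume
  integral_eq : ∀ ψ : EuclideanSpace ℝ (Fin n) → ℝ, ContDiff ℝ ∞ ψ → HasCompactSupport ψ →
    tsupport ψ ⊆ Ω → ∀ i : Fin n,
      ∫ x in Ω, f x * fderiv ℝ ψ x (EuclideanSpace.single i 1) = - ∫ x in Ω, g x i * ψ x

/-- Weak gradients are unique up to null sets. -/
theorem HasWeakGradient.ae_eq {n : ℕ} {Ω : Set (EuclideanSpace ℝ (Fin n))} (hΩ : IsOpen Ω)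
    {f : EuclideanSpace ℝ (Fin n) → ℝ}
    {g₁ g₂ : EuclideanSpace ℝ (Fin n) → EuclideanSpace ℝ (Fin n)}
    (h₁ : HasWeakGradient Ω f g₁) (h₂ : HasWeakGradient Ω f g₂) :
    g₁ =ᵐ[volume.restrict Ω] g₂ := by
  have hcoord : ∀ i : Fin n, ∀ᵐ x ∂volume, x ∈ Ω → g₁ x i - g₂ x i = 0 := by
    intro i
    have hli : ∀ g : EuclideanSpace ℝ (Fin n) → EuclideanSpace ℝ (Fin n),
        LocallyIntegrableOn g Ω volume → LocallyIntegrableOn (fun x => g x i) Ω volume := by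
      intro g hg x hx
      obtain ⟨s, hs, hgs⟩ := hg x hx
      exact ⟨s, hs, (EuclideanSpace.proj (𝕜 := ℝ) i).integrable_comp hgs⟩
    have l₁ := hli g₁ h₁.locallyIntegrableOn_grad
    have l₂ := hli g₂ h₂.locallyIntegrableOn_grad
    refine hΩ.ae_eq_zero_of_integral_contDiff_smul_eq_zero (l₁.sub l₂) ?_
    intro ψ hψ hc hsub
    have key : ∀ u : EuclideanSpace ℝ (Fin n) → ℝ, LocallyIntegrableOn u Ω volume →
        Integrable (fun x => ψ x • u x) volume ∧
          ∫ x, ψ x • u x = ∫ x in Ω, u x * ψ x := by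
      intro u hu
      constructor
      · have hu' : IntegrableOn u (tsupport ψ) volume := hu.integrableOn_compact_subset hsub hc
        have h3 : IntegrableOn (fun x => ψ x • u x) (tsupport ψ) volume :=
          hu'.continuousOn_smul hψ.continuous.continuousOn hc
        refine (integrableOn_iff_integrable_of_support_subset ?_).1 h3
        intro x hx
        refine subset_tsupport ψ ?_
        intro h0
        exact hx (by simp [h0])
      · rw [setIntegral_eq_integral_of_forall_compl_eq_zero]
        · simp [mul_comm]
        · intro x hx
          have : ψ x = 0 := by
            by_contra h0
            exact hx (hsub (subset_tsupport ψ h0))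
          simp [this]
    obtain ⟨i₁, e₁⟩ := key _ l₁
    obtain ⟨i₂, e₂⟩ := key _ l₂
    have a₁ := h₁.integral_eq ψ hψ hc hsub i
    have a₂ := h₂.integral_eq ψ hψ hc hsub i
    simp only [smul_sub]
    rw [integral_sub i₁ i₂, e₁, e₂]
    linarith
  rw [Filter.EventuallyEq, ae_restrict_iff' hΩ.measurableSet]
  filter_upwards [ae_all_iff.2 hcoord] with x hx hxΩ
  ext i
  exact sub_eq_zero.1 (hx i hxΩ)

/-- `f ∈ W^{1,p}(Ω)`: `f ∈ L^p(Ω)`, and `f` has a weak gradient on `Ω` that lies in `L^p(Ω)`. -/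
def MemSobolev {n : ℕ} (Ω : Set (EuclideanSpace ℝ (Fin n))) (p : ℝ≥0∞)
    (f : EuclideanSpace ℝ (Fin n) → ℝ) : Prop :=
  MemLp f p (volume.restrict Ω) ∧
    ∃ g : EuclideanSpace ℝ (Fin n) → EuclideanSpace ℝ (Fin n),
      HasWeakGradient Ω f g ∧ MemLp g p (volume.restrict Ω)

open Classical in
/-- The weak gradient `∇f` of `f` on `Ω` (unique up to null sets; `0` if there is none). -/
noncomputable def weakGradient {n : ℕ} (Ω : Set (EuclideanSpace ℝ (Fin n)))
    (f : EuclideanSpace ℝ (Fin n) → ℝ) : EuclideanSpace ℝ (Fin n) → EuclideanSpace ℝ (Fin n) :=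
  if h : ∃ g, HasWeakGradient Ω f g then h.choose else 0

/-- `‖f‖_{W^{1,p}(Ω)} = ‖f‖_{L^p(Ω)} + ‖∇f‖_{L^p(Ω)}`, to be used for `f ∈ W^{1,p}(Ω)`. -/
noncomputable def sobolevNorm {n : ℕ} (Ω : Set (EuclideanSpace ℝ (Fin n))) (p : ℝ≥0∞)
    (f : EuclideanSpace ℝ (Fin n) → ℝ) : ℝ≥0∞ :=
  eLpNorm f p (volume.restrict Ω) + eLpNorm (weakGradient Ω f) p (volume.restrict Ω)

/-- The growth function `φ(t) = (1 + t)^γ`. -/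
noncomputable def growthFun (γ t : ℝ) : ℝ := (1 + t) ^ γ

/-- The local fractional new maximal function `M_{φ,β,Ω} f`, with values in `[0, ∞]`. The supremum
is over all radii `0 < r < dist(x, Ωᶜ)`, where the distance to the empty set is `∞`. -/
noncomputable def localFracMaximal {n : ℕ} (γ β : ℝ) (Ω : Set (EuclideanSpace ℝ (Fin n)))
    (f : EuclideanSpace ℝ (Fin n) → ℝ) (x : EuclideanSpace ℝ (Fin n)) : ℝ≥0∞ :=
  ⨆ (r : ℝ) (_ : 0 < r) (_ : ENNReal.ofReal r < Metric.infEDist x Ωᶜ),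
    ENNReal.ofReal (r ^ β * (1 + r ^ n) ^ (γ * β / n) /
      (growthFun γ (volume.real (Metric.ball x r)) * volume.real (Metric.ball x r))) *
      ∫⁻ y in Metric.ball x r, ‖f y‖ₑ

/-! Since `Ω` has finite measure, balls inside `Ω` have radius at most some `R`. After rescaling to
the unit ball, each term of the supremum is `w(r) A_f(x,r)`, where `A_f(x,r)` is the integral of
`|f(x + r y)|` over `|y| < 1` and the weight `w(r)` is `r^β` times a factor smooth on `[0,R]`. Hence
`|w|` and `|w'|` are both at most `C r^(β-1)` on `(0,R]`.

By mollification, `A_f` has pointwise slope at most `A_g(x,r)` in the variables `(x,r)`, with `g =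
∇f`: moving `x` and `r` displaces `x + r y` by at most `|dx| + |dr|`. Take `r = t · dist(x, Ωᶜ)`
with `t` rational in `(0,1)`. This radius is 1-Lipschitz in `x`, so `x ↦ w(r) A_f(x,r)` has slope at
most `2C r^(β-1) (A_f + A_g)`, which is at most `G := 2C M_{β-1}(|f| + |g|)`, uniformly in `t`; here
`M_{β-1}` is the fractional maximal function of order `β - 1`. Along any segment in `Ω` the
increment is therefore at most the line integral of `G`. Such a bound passes to the supremum over
`t`, which is the local maximal function.

Control of increments by line integrals bounds the distributional derivatives: `|∫ F ∂ψ| ≤ ∫ |ψ| G`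
for test functions (`enorm_integral_mul_fderiv_le`). Duality in a weighted `L¹` then yields a weak
gradient dominated by `n G` (`exists_weak_derivative_of_abs_le`,
`exists_hasWeakGradient_of_segment_le`). The exponent relation is exactly the one for which
`M_{β-1}` maps `L^p` to `L^q`; this is proved from the Vitali covering lemma, the Hardy–Littlewood
theorem and Hedberg's inequality (`exists_lintegral_fracMaximal_rpow_le`). -/

/-! ### Bounds for the global fractional maximal function. -/

section FractionalMaximal

variable {E : Type*} [NormedAddCommGroup E] [NormedSpace ℝ E] [MeasurableSpace E] (μ : Measure E)

/-- The fractional maximal function of order `α`, over centred balls of radius at most `R`. -/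
noncomputable def fracMaximal (α R : ℝ) (g : E → ℝ≥0∞) (x : E) : ℝ≥0∞ :=
  ⨆ (r : ℝ) (_ : 0 < r) (_ : r ≤ R),
    ENNReal.ofReal (r ^ (α - Module.finrank ℝ E)) * ∫⁻ y in Metric.ball x r, g y ∂μ

variable {μ} in
theorem le_fracMaximal {α R r : ℝ} (hr : 0 < r) (hrR : r ≤ R) (g : E → ℝ≥0∞) (x : E) :
    ENNReal.ofReal (r ^ (α - Module.finrank ℝ E)) * ∫⁻ y in Metric.ball x r, g y ∂μ
      ≤ fracMaximal μ α R g x :=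
  le_iSup_of_le r (le_iSup_of_le hr (le_iSup_of_le hrR le_rfl))

variable [BorelSpace E]

/-- An open ball is an increasing union of smaller concentric balls, and each of these stays inside
the ball of radius `r` around any sufficiently close centre. This gives measurability of the maximal
function without any measurability of `g`. -/
theorem lowerSemicontinuous_setLIntegral_ball {E : Type*} [PseudoMetricSpace E]
    [MeasurableSpace E] [BorelSpace E] (μ : Measure E) (g : E → ℝ≥0∞) (r : ℝ) :
    LowerSemicontinuous fun x => ∫⁻ y in Metric.ball x r, g y ∂μ := by
  intro x c hc
  have hU : Metric.ball x r = ⋃ k : ℕ, Metric.ball x (r - 1 / ((k : ℝ) + 1)) := by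
    ext y
    simp only [Metric.mem_ball, Set.mem_iUnion]
    constructor
    · intro h
      obtain ⟨k, hk⟩ := exists_nat_one_div_lt (sub_pos.2 h)
      exact ⟨k, by linarith⟩
    · rintro ⟨k, hk⟩
      have : 0 < 1 / ((k : ℝ) + 1) := by positivity
      linarith
  have hmono : Monotone fun k : ℕ => Metric.ball x (r - 1 / ((k : ℝ) + 1)) := by
    intro i j hij
    apply Metric.ball_subset_ball
    have : 1 / ((j : ℝ) + 1) ≤ 1 / ((i : ℝ) + 1) := Nat.one_div_le_one_div hij
    linarith
  have hν : ∀ z s, ∫⁻ y in Metric.ball z s, g y ∂μ = μ.withDensity g (Metric.ball z s) :=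
    fun z s => (withDensity_apply _ measurableSet_ball).symm
  simp only [hν] at hc ⊢
  rw [hU, hmono.measure_iUnion] at hc
  obtain ⟨k, hk⟩ := lt_iSup_iff.1 hc
  have hpos : 0 < 1 / ((k : ℝ) + 1) := by positivity
  filter_upwards [Metric.ball_mem_nhds x hpos] with z hz
  refine hk.trans_le (measure_mono ?_)
  apply Metric.ball_subset_ball'
  rw [dist_comm]
  linarith [Metric.mem_ball.1 hz]

theorem measurable_fracMaximal (α R : ℝ) (g : E → ℝ≥0∞) : Measurable (fracMaximal μ α R g) := by
  apply LowerSemicontinuous.measurable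
  refine lowerSemicontinuous_iSup fun r => lowerSemicontinuous_iSup fun _ =>
    lowerSemicontinuous_iSup fun _ => ?_
  intro x c hc
  have hcont : Continuous fun t : ℝ≥0∞ => ENNReal.ofReal (r ^ (α - Module.finrank ℝ E)) * t :=
    ENNReal.continuous_const_mul ENNReal.ofReal_ne_top
  exact hcont.continuousAt.comp_lowerSemicontinuousAt
    (lowerSemicontinuous_setLIntegral_ball μ g r x) (fun a b h => by dsimp only; gcongr) c hc

variable [FiniteDimensional ℝ E] [μ.IsAddHaarMeasure]

/-- Weak type (1,1): each point of the superlevel set has a ball on which `g` has large mass. The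
Vitali lemma, applicable because radii are at most `R`, selects disjoint balls whose fivefold
enlargements cover the set; this is the source of `5 ^ finrank`. -/
theorem mul_measure_lt_fracMaximal_le (R : ℝ) (g : E → ℝ≥0∞) (l : ℝ≥0∞) :
    l * μ {x | l < fracMaximal μ 0 R g x} ≤
      ENNReal.ofReal (5 ^ Module.finrank ℝ E) * μ (Metric.ball 0 1) * ∫⁻ y, g y ∂μ := by
  set t := {x | l < fracMaximal μ 0 R g x} with ht
  have hex : ∀ x : E, ∃ r : ℝ, x ∈ t → 0 < r ∧ r ≤ R ∧
      l * ENNReal.ofReal (r ^ Module.finrank ℝ E) ≤ ∫⁻ y in Metric.ball x r, g y ∂μ := by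
    intro x
    by_cases hx : x ∈ t
    · simp only [ht, Set.mem_ofPred_eq, fracMaximal, lt_iSup_iff] at hx
      obtain ⟨r, hr, hrR, h⟩ := hx
      refine ⟨r, fun _ => ⟨hr, hrR, ?_⟩⟩
      calc l * ENNReal.ofReal (r ^ Module.finrank ℝ E)
          ≤ (ENNReal.ofReal (r ^ ((0:ℝ) - Module.finrank ℝ E)) *
              ∫⁻ y in Metric.ball x r, g y ∂μ) * ENNReal.ofReal (r ^ Module.finrank ℝ E) := by
            gcongr
        _ = (ENNReal.ofReal (r ^ ((0:ℝ) - Module.finrank ℝ E)) *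
              ENNReal.ofReal (r ^ Module.finrank ℝ E)) * ∫⁻ y in Metric.ball x r, g y ∂μ := by
            ring
        _ = _ := by
            rw [← ENNReal.ofReal_mul (by positivity), zero_sub, Real.rpow_neg hr.le,
              Real.rpow_natCast, inv_mul_cancel₀ (by positivity), ENNReal.ofReal_one, one_mul]
    · exact ⟨0, fun h => absurd h hx⟩
  choose r hr using hex
  obtain ⟨u, hut, hdisj, hcov⟩ := Vitali.exists_disjoint_subfamily_covering_enlargement_ball t
    (fun x : E => x) r R (fun x hx => (hr x hx).2.1) 5 (by norm_num)
  have hucount : u.Countable := hdisj.countable_of_isOpen (fun _ _ => Metric.isOpen_ball)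
    fun x hx => Metric.nonempty_ball.2 (hr x (hut hx)).1
  have htu : t ⊆ ⋃ b ∈ u, Metric.ball b (5 * r b) := by
    intro x hx
    obtain ⟨b, hb, hsub⟩ := hcov x hx
    exact Set.mem_biUnion hb (hsub (Metric.mem_ball_self (hr x hx).1))
  have := hucount.to_subtype
  calc l * μ t ≤ l * ∑' b : u, μ (Metric.ball (b : E) (5 * r b)) := by
        gcongr
        exact (measure_mono htu).trans (measure_biUnion_le μ hucount _)
    _ = ∑' b : u, l * μ (Metric.ball (b : E) (5 * r b)) := by rw [ENNReal.tsum_mul_left]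
    _ ≤ ∑' b : u, ENNReal.ofReal (5 ^ Module.finrank ℝ E) * μ (Metric.ball 0 1) *
          ∫⁻ y in Metric.ball (b : E) (r b), g y ∂μ := by
        refine ENNReal.tsum_le_tsum fun b => ?_
        obtain ⟨h0, -, h⟩ := hr b (hut b.2)
        rw [Measure.addHaar_ball_of_pos μ _ (by positivity), mul_pow,
          ENNReal.ofReal_mul (by positivity)]
        calc _ = ENNReal.ofReal (5 ^ Module.finrank ℝ E) * μ (Metric.ball 0 1) *
              (l * ENNReal.ofReal (r b ^ Module.finrank ℝ E)) := by ring
          _ ≤ _ := by gcongr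
    _ = ENNReal.ofReal (5 ^ Module.finrank ℝ E) * μ (Metric.ball 0 1) *
          ∫⁻ y in ⋃ b ∈ u, Metric.ball b (r b), g y ∂μ := by
        rw [ENNReal.tsum_mul_left, lintegral_biUnion hucount (fun _ _ => measurableSet_ball) hdisj]
    _ ≤ _ := by
        exact mul_le_mul_right (setLIntegral_le_lintegral _ _) _

/-- The weak-type bound at the levels `k = 0, 1, 2, …` bounds `k` times the measure of the infinity
set uniformly. -/
theorem ae_fracMaximal_zero_lt_top (R : ℝ) {g : E → ℝ≥0∞} (hg : ∫⁻ y, g y ∂μ ≠ ⊤) :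
    ∀ᵐ x ∂μ, fracMaximal μ 0 R g x < ⊤ := by
  set C := ENNReal.ofReal (5 ^ Module.finrank ℝ E) * μ (Metric.ball 0 1) * ∫⁻ y, g y ∂μ
  have hC : C ≠ ⊤ := ENNReal.mul_ne_top (ENNReal.mul_ne_top ENNReal.ofReal_ne_top
    measure_ball_lt_top.ne) hg
  have key : ∀ k : ℕ, (k : ℝ≥0∞) * μ {x | ¬ fracMaximal μ 0 R g x < ⊤} ≤ C := fun k => by
    refine le_trans ?_ (mul_measure_lt_fracMaximal_le μ R g k)
    gcongr with x
    intro hx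
    rw [not_lt, top_le_iff] at hx
    rw [hx]; exact ENNReal.natCast_lt_top k
  rw [ae_iff]
  by_contra h0
  obtain ⟨k, hk⟩ := ENNReal.exists_nat_mul_gt h0 hC
  exact absurd (key k) (not_le.2 hk)

/-- The truncation for Marcinkiewicz interpolation: values of `g` not exceeding `s` contribute at
most `s` times the volume of the unit ball. -/
theorem fracMaximal_zero_le_add {R : ℝ} {g : E → ℝ≥0∞} (s : ℝ≥0∞) (x : E) :
    fracMaximal μ 0 R g x ≤
      fracMaximal μ 0 R ({y | s < g y}.indicator g) x + s * μ (Metric.ball 0 1) := by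
  refine iSup_le fun r => iSup_le fun hr => iSup_le fun hrR => ?_
  calc _ ≤ ENNReal.ofReal (r ^ ((0:ℝ) - Module.finrank ℝ E)) *
        ∫⁻ y in Metric.ball x r, ({y | s < g y}.indicator g y + s) ∂μ := by
        gcongr with y
        by_cases h : s < g y
        · rw [Set.indicator_of_mem (by exact h)]; exact le_self_add
        · exact (not_lt.1 h).trans le_add_self
    _ = ENNReal.ofReal (r ^ ((0:ℝ) - Module.finrank ℝ E)) *
          ∫⁻ y in Metric.ball x r, {y | s < g y}.indicator g y ∂μ +
        s * (ENNReal.ofReal (r ^ ((0:ℝ) - Module.finrank ℝ E)) * μ (Metric.ball x r)) := by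
        rw [lintegral_add_right _ measurable_const, setLIntegral_const]; ring
    _ ≤ _ := by
        gcongr
        · exact le_fracMaximal hr hrR _ x
        · rw [Measure.addHaar_ball_of_pos μ _ hr, ← mul_assoc, ← ENNReal.ofReal_mul (by positivity),
            zero_sub, Real.rpow_neg hr.le, Real.rpow_natCast, inv_mul_cancel₀ (by positivity),
            ENNReal.ofReal_one, one_mul]

theorem lintegral_Ioi_rpow_indicator_Iio {p : ℝ} (hp : 1 < p) {T : ℝ} (hT : 0 ≤ T) :
    ∫⁻ t in Set.Ioi (0 : ℝ), (Set.Iio T).indicator (fun t => ENNReal.ofReal (t ^ (p - 2))) t =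
      ENNReal.ofReal (T ^ (p - 1) / (p - 1)) := by
  rw [setLIntegral_indicator measurableSet_Iio, Set.inter_comm, Set.Ioi_inter_Iio,
    restrict_Ioo_eq_restrict_Ioc]
  have hint : IntervalIntegrable (fun t : ℝ => t ^ (p - 2)) volume 0 T :=
    intervalIntegral.intervalIntegrable_rpow' (by linarith)
  rw [← ofReal_integral_eq_lintegral_ofReal ((intervalIntegrable_iff_integrableOn_Ioc_of_le hT).1
    hint), ← intervalIntegral.integral_of_le hT, integral_rpow (Or.inl (by linarith)),
    show p - 2 + 1 = p - 1 by ring, Real.zero_rpow (by linarith), sub_zero]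
  exact (ae_restrict_iff' measurableSet_Ioc).2 (.of_forall fun t ht => Real.rpow_nonneg ht.1.le _)

/-- The Hardy–Littlewood maximal theorem. -/
theorem exists_lintegral_fracMaximal_zero_rpow_le {p : ℝ} (hp : 1 < p) :
    ∃ C : ℝ≥0, ∀ (R : ℝ) (g : E → ℝ≥0∞), Measurable g → ∫⁻ y, g y ∂μ ≠ ⊤ →
      ∫⁻ x, fracMaximal μ 0 R g x ^ p ∂μ ≤ C * ∫⁻ x, g x ^ p ∂μ := by
  set b : ℝ := μ.real (Metric.ball (0 : E) 1) with hb
  have hbpos : 0 < b := ENNReal.toReal_pos (Metric.measure_ball_pos μ _ one_pos).ne'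
    measure_ball_lt_top.ne
  have hbE : μ (Metric.ball (0 : E) 1) = ENNReal.ofReal b := by
    rw [hb, ofReal_measureReal measure_ball_lt_top.ne]
  set K : ℝ≥0∞ := ENNReal.ofReal (5 ^ Module.finrank ℝ E) * μ (Metric.ball 0 1) with hK
  have hKtop : K ≠ ⊤ := ENNReal.mul_ne_top ENNReal.ofReal_ne_top measure_ball_lt_top.ne
  set A : ℝ≥0∞ := ENNReal.ofReal p * (ENNReal.ofReal 2 * K) *
    ENNReal.ofReal ((2 * b) ^ (p - 1) / (p - 1)) with hA
  have hAtop : A ≠ ⊤ := ENNReal.mul_ne_top (ENNReal.mul_ne_top ENNReal.ofReal_ne_top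
    (ENNReal.mul_ne_top ENNReal.ofReal_ne_top hKtop)) ENNReal.ofReal_ne_top
  refine ⟨A.toNNReal, fun R g hg hgint => ?_⟩
  rw [ENNReal.coe_toNNReal hAtop]
  have hfin := ae_fracMaximal_zero_lt_top μ R hgint
  have hgfin : ∀ᵐ x ∂μ, g x < ⊤ := ae_lt_top hg hgint
  calc ∫⁻ x, fracMaximal μ 0 R g x ^ p ∂μ
      = ∫⁻ x, ENNReal.ofReal ((fracMaximal μ 0 R g x).toReal ^ p) ∂μ := by
        refine lintegral_congr_ae (hfin.mono fun x hx => ?_)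
        dsimp only
        rw [← ENNReal.ofReal_rpow_of_nonneg ENNReal.toReal_nonneg (by linarith),
          ENNReal.ofReal_toReal hx.ne]
    -- Layer-cake formula. The weak-type bound is next applied at each height `t` to a truncation of
    -- `g` depending on `t`, and Tonelli then lets the `t`-integral be computed explicitly.
    _ = ENNReal.ofReal p * ∫⁻ t in Set.Ioi 0, μ {a | t < (fracMaximal μ 0 R g a).toReal} *
          ENNReal.ofReal (t ^ (p - 1)) :=
        lintegral_rpow_eq_lintegral_meas_lt_mul μ (.of_forall fun _ => ENNReal.toReal_nonneg)
          (measurable_fracMaximal μ 0 R g).ennreal_toReal.aemeasurable (by linarith)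
    _ ≤ ENNReal.ofReal p * ∫⁻ t in Set.Ioi (0 : ℝ), ENNReal.ofReal 2 * K * ∫⁻ x, g x *
          (Set.Iio (2 * b * (g x).toReal)).indicator (fun t => ENNReal.ofReal (t ^ (p - 2))) t
            ∂μ := by
        refine mul_le_mul_right (setLIntegral_mono_ae' measurableSet_Ioi
          (.of_forall fun t (ht : 0 < t) => ?_)) _
        -- With this cut-off the part of `g` below `s` contributes at most `t / 2`, so where the
        -- maximal function of `g` exceeds `t`, that of the part above `s` exceeds `t / 2`.
        set s := ENNReal.ofReal (t / (2 * b)) with hs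
        have hsub : {a | t < (fracMaximal μ 0 R g a).toReal} ⊆
            {a | ENNReal.ofReal (t / 2) < fracMaximal μ 0 R ({y | s < g y}.indicator g) a} := by
          intro a (ha : t < _)
          have h1 : ENNReal.ofReal t < fracMaximal μ 0 R g a :=
            (ENNReal.ofReal_lt_iff_lt_toReal ht.le
              (fun h => by rw [h] at ha; simp at ha; linarith)).2 ha
          have h2 := fracMaximal_zero_le_add μ (R := R) (g := g) s a
          have h3 : s * μ (Metric.ball (0 : E) 1) = ENNReal.ofReal (t / 2) := by
            rw [hbE, hs, ← ENNReal.ofReal_mul (by positivity)]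
            congr 1; field_simp
          rw [h3] at h2
          change ENNReal.ofReal (t / 2) < _
          refine lt_of_not_ge fun hcon => ?_
          have h4 : fracMaximal μ 0 R g a ≤ ENNReal.ofReal (t / 2) + ENNReal.ofReal (t / 2) :=
            h2.trans (by gcongr)
          rw [← ENNReal.ofReal_add (by positivity) (by positivity), add_halves] at h4
          exact absurd h4 (not_le.2 h1)
        have hweak := mul_measure_lt_fracMaximal_le μ R ({y | s < g y}.indicator g)
          (ENNReal.ofReal (t / 2))
        have hsplit : ENNReal.ofReal (t ^ (p - 1)) =
            ENNReal.ofReal 2 * ENNReal.ofReal (t ^ (p - 2)) * ENNReal.ofReal (t / 2) := by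
          rw [← ENNReal.ofReal_mul (by norm_num), ← ENNReal.ofReal_mul (by positivity)]
          congr 1
          rw [show p - 1 = (p - 2) + 1 by ring, Real.rpow_add_one ht.ne']
          ring
        calc _ ≤ ENNReal.ofReal 2 * ENNReal.ofReal (t ^ (p - 2)) * (ENNReal.ofReal (t / 2) *
              μ {a | ENNReal.ofReal (t / 2) <
                fracMaximal μ 0 R ({y | s < g y}.indicator g) a}) := by
              rw [hsplit, mul_comm, ← mul_assoc]
              gcongr
          _ ≤ ENNReal.ofReal 2 * ENNReal.ofReal (t ^ (p - 2)) *
                (K * ∫⁻ y, {y | s < g y}.indicator g y ∂μ) := by gcongr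
          _ = ENNReal.ofReal 2 * K * ∫⁻ y, ENNReal.ofReal (t ^ (p - 2)) *
                {y | s < g y}.indicator g y ∂μ := by
              rw [lintegral_const_mul' _ _ ENNReal.ofReal_ne_top]; ring
          _ ≤ _ := by
              refine mul_le_mul_right (lintegral_mono_ae (hgfin.mono fun x hx => ?_)) _
              by_cases h : s < g x
              · have hlt : t < 2 * b * (g x).toReal := by
                  have := (ENNReal.ofReal_lt_iff_lt_toReal (by positivity) hx.ne).1 h
                  rw [div_lt_iff₀ (by positivity)] at this
                  linarith
                rw [Set.indicator_of_mem (by exact h), Set.indicator_of_mem (by exact hlt),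
                  mul_comm]
              · rw [Set.indicator_of_notMem (by exact h), mul_zero]; exact zero_le
    _ = ENNReal.ofReal p * (ENNReal.ofReal 2 * K * ∫⁻ x, g x * (∫⁻ t in Set.Ioi (0 : ℝ),
          (Set.Iio (2 * b * (g x).toReal)).indicator (fun t => ENNReal.ofReal (t ^ (p - 2))) t)
            ∂μ) := by
        rw [lintegral_const_mul' _ _ (ENNReal.mul_ne_top ENNReal.ofReal_ne_top hKtop),
          lintegral_lintegral_swap]
        · congr 2
          refine lintegral_congr_ae (hgfin.mono fun x hx => ?_)
          exact lintegral_const_mul' _ _ hx.ne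
        · refine Measurable.aemeasurable ?_
          have hset : MeasurableSet {z : ℝ × E | z.1 < 2 * b * (g z.2).toReal} :=
            measurableSet_lt measurable_fst ((hg.comp measurable_snd).ennreal_toReal.const_mul _)
          have : Measurable fun z : ℝ × E => {z : ℝ × E | z.1 < 2 * b * (g z.2).toReal}.indicator
              (fun z => ENNReal.ofReal (z.1 ^ (p - 2))) z :=
            Measurable.indicator (by fun_prop) hset
          exact (hg.comp measurable_snd).mul this
    _ = ENNReal.ofReal p * (ENNReal.ofReal 2 * K *
          ∫⁻ x, ENNReal.ofReal ((2 * b) ^ (p - 1) / (p - 1)) * g x ^ p ∂μ) := by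
        congr 2
        refine lintegral_congr_ae (hgfin.mono fun x hx => ?_)
        dsimp only
        rw [lintegral_Ioi_rpow_indicator_Iio hp (by positivity),
          Real.mul_rpow (by positivity) ENNReal.toReal_nonneg, mul_div_right_comm,
          ENNReal.ofReal_mul (div_nonneg (by positivity) (by linarith)),
          ← ENNReal.ofReal_rpow_of_nonneg ENNReal.toReal_nonneg (by linarith),
          ENNReal.ofReal_toReal hx.ne, mul_left_comm]
        congr 1
        nth_rw 1 [← ENNReal.rpow_one (g x)]
        rw [← ENNReal.rpow_add_of_nonneg _ _ zero_le_one (by linarith), add_sub_cancel]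
    _ = A * ∫⁻ x, g x ^ p ∂μ := by
        rw [lintegral_const_mul' _ _ ENNReal.ofReal_ne_top, hA]; ring

/-- The Hardy–Littlewood–Sobolev bound for the fractional maximal function, by Hedberg's
inequality. -/
theorem exists_lintegral_fracMaximal_rpow_le {p q α : ℝ} (hp : 1 < p) (hα : 0 ≤ α)
    (hαp : α * p < Module.finrank ℝ E) (hq : 1 / q = 1 / p - α / Module.finrank ℝ E) :
    ∃ C : ℝ≥0, ∀ (R : ℝ) (g : E → ℝ≥0∞), Measurable g → ∫⁻ y, g y ∂μ ≠ ⊤ →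
      ∫⁻ x, fracMaximal μ α R g x ^ q ∂μ ≤ C * (∫⁻ x, g x ^ p ∂μ) ^ (q / p) := by
  obtain ⟨C, hC⟩ := exists_lintegral_fracMaximal_zero_rpow_le μ hp
  set d : ℝ := (Module.finrank ℝ E : ℝ) with hd
  have hd0 : 0 < d := lt_of_le_of_lt (by positivity) hαp
  -- Hedberg's interpolation exponent: it makes the powers of `r` cancel, `α - (d / p) θ = 0`, and
  -- the relation between `p` and `q` becomes `(1 - θ) q = p`.
  set θ := α * p / d with hθ
  have hθ0 : 0 ≤ θ := by positivity
  have hθ1 : θ < 1 := (div_lt_one hd0).2 hαp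
  have hq' : 1 / q = (1 - θ) / p := by rw [hq, hθ]; field_simp
  have hq0 : 0 < q := one_div_pos.1 (hq' ▸ div_pos (by linarith) (by linarith))
  have hqp : (1 - θ) * q = p := by field_simp at hq'; linarith
  have hpq : p ≤ q := by nlinarith
  set B := (μ (Metric.ball (0 : E) 1)) ^ (1 - 1 / p) with hB
  have hBtop : B ≠ ⊤ := ENNReal.rpow_ne_top_of_nonneg
    (by rw [sub_nonneg, div_le_one (by linarith)]; exact hp.le) measure_ball_lt_top.ne
  have hpc : p.HolderConjugate (1 - 1 / p)⁻¹ := by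
    rw [Real.holderConjugate_iff]; simp [hp]
  set D := B ^ (θ * q) * C with hD
  have hDtop : D ≠ ⊤ := ENNReal.mul_ne_top (ENNReal.rpow_ne_top_of_nonneg (by positivity) hBtop)
    ENNReal.coe_ne_top
  refine ⟨D.toNNReal, fun R g hg hgint => ?_⟩
  rw [ENNReal.coe_toNNReal hDtop]
  set N := (∫⁻ x, g x ^ p ∂μ) ^ (1 / p) with hN
  have hpt : ∀ x, fracMaximal μ α R g x ≤ (B * N) ^ θ * fracMaximal μ 0 R g x ^ (1 - θ) := by
    intro x
    refine iSup_le fun r => iSup_le fun hr => iSup_le fun hrR => ?_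
    set X := ENNReal.ofReal (r ^ ((0 : ℝ) - d)) * ∫⁻ y in Metric.ball x r, g y ∂μ with hX
    have hXM : X ≤ fracMaximal μ 0 R g x := le_fracMaximal hr hrR g x
    have hhold : ∫⁻ y in Metric.ball x r, g y ∂μ ≤ N * μ (Metric.ball x r) ^ (1 - 1 / p) := by
      have := ENNReal.lintegral_mul_le_Lp_mul_Lq (μ.restrict (Metric.ball x r)) hpc
        hg.aemeasurable (aemeasurable_const (b := (1 : ℝ≥0∞)))
      simp only [Pi.mul_apply, mul_one, ENNReal.one_rpow, lintegral_const, one_mul,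
        Measure.restrict_apply_univ, one_div, inv_inv] at this
      refine this.trans ?_
      rw [hN, one_div]
      gcongr
      exact Measure.restrict_le_self
    have hX2 : X ≤ ENNReal.ofReal (r ^ (-(d / p))) * (B * N) := by
      calc X ≤ ENNReal.ofReal (r ^ ((0 : ℝ) - d)) *
            (N * μ (Metric.ball x r) ^ (1 - 1 / p)) := by rw [hX]; gcongr
        _ = _ := by
          rw [Measure.addHaar_ball_of_pos μ _ hr, ENNReal.mul_rpow_of_ne_top
            ENNReal.ofReal_ne_top measure_ball_lt_top.ne, ← hB,
            ENNReal.ofReal_rpow_of_pos (by positivity), ← Real.rpow_natCast, ← Real.rpow_mul hr.le,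
            ← hd]
          rw [show -(d / p) = ((0 : ℝ) - d) + d * (1 - 1 / p) by ring, Real.rpow_add hr,
            ENNReal.ofReal_mul (by positivity)]
          ring
    -- The average `X` is split as `X ^ θ * X ^ (1 - θ)`. Hölder's bound `hX2` is used for the first
    -- factor and the maximal function of order zero for the second.
    have hXeq : ENNReal.ofReal (r ^ (α - d)) * ∫⁻ y in Metric.ball x r, g y ∂μ =
        ENNReal.ofReal (r ^ α) * (X ^ θ * X ^ (1 - θ)) := by
      rw [← ENNReal.rpow_add_of_nonneg _ _ hθ0 (by linarith), add_sub_cancel, ENNReal.rpow_one, hX,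
        ← mul_assoc, ← ENNReal.ofReal_mul (by positivity), ← Real.rpow_add hr, zero_sub,
        ← sub_eq_add_neg]
    rw [hXeq, ← mul_assoc]
    gcongr
    calc ENNReal.ofReal (r ^ α) * X ^ θ
        ≤ ENNReal.ofReal (r ^ α) * (ENNReal.ofReal (r ^ (-(d / p))) * (B * N)) ^ θ := by gcongr
      _ = (B * N) ^ θ := by
        rw [ENNReal.mul_rpow_of_nonneg _ _ hθ0, ENNReal.ofReal_rpow_of_pos (by positivity),
          ← Real.rpow_mul hr.le, ← mul_assoc, ← ENNReal.ofReal_mul (by positivity),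
          ← Real.rpow_add hr, hθ, show α + -(d / p) * (α * p / d) = 0 by field_simp; ring,
          Real.rpow_zero, ENNReal.ofReal_one, one_mul]
  have hpow : ∀ x, fracMaximal μ α R g x ^ q ≤
      (B * N) ^ (θ * q) * fracMaximal μ 0 R g x ^ p := by
    intro x
    calc _ ≤ ((B * N) ^ θ * fracMaximal μ 0 R g x ^ (1 - θ)) ^ q := by gcongr; exact hpt x
      _ = _ := by
        rw [ENNReal.mul_rpow_of_nonneg _ _ hq0.le, ← ENNReal.rpow_mul, ← ENNReal.rpow_mul, hqp]
  calc ∫⁻ x, fracMaximal μ α R g x ^ q ∂μ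
      ≤ ∫⁻ x, (B * N) ^ (θ * q) * fracMaximal μ 0 R g x ^ p ∂μ := lintegral_mono hpow
    _ = (B * N) ^ (θ * q) * ∫⁻ x, fracMaximal μ 0 R g x ^ p ∂μ :=
        lintegral_const_mul _ ((measurable_fracMaximal μ 0 R g).pow_const _)
    _ ≤ (B * N) ^ (θ * q) * (C * ∫⁻ x, g x ^ p ∂μ) := by gcongr; exact hC R g hg hgint
    _ = D * (∫⁻ x, g x ^ p ∂μ) ^ (q / p) := by
        rw [ENNReal.mul_rpow_of_nonneg _ _ (by positivity), hN,
          ← ENNReal.rpow_mul (∫⁻ x, g x ^ p ∂μ), hD]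
        have : q / p = 1 / p * (θ * q) + 1 := by
          rw [eq_comm, ← sub_eq_zero]; field_simp; linarith
        rw [this, ENNReal.rpow_add_of_nonneg _ _ (by positivity) zero_le_one, ENNReal.rpow_one]
        ring

end FractionalMaximal

/-! ### Ball averages rescaled to the unit ball. -/

section BallAverages

theorem enorm_sub_le_lintegral_fderiv {E : Type*} [NormedAddCommGroup E] [NormedSpace ℝ E]
    {F : E → ℝ} (hF : ContDiff ℝ 1 F) (a b : E) :
    ‖F b - F a‖ₑ ≤ ∫⁻ s in Set.Ioc (0 : ℝ) 1, ‖fderiv ℝ F (a + s • (b - a))‖ₑ * ‖b - a‖ₑ := by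
  have hd : ∀ s : ℝ, HasDerivAt (fun s : ℝ => F (a + s • (b - a)))
      (fderiv ℝ F (a + s • (b - a)) (b - a)) s := by
    intro s
    have h1 : HasDerivAt (fun s : ℝ => a + s • (b - a)) (b - a) s := by
      simpa using ((hasDerivAt_id s).smul_const (b - a)).const_add a
    exact (hF.differentiable one_ne_zero _).hasFDerivAt.comp_hasDerivAt s h1
  have hc : Continuous fun s : ℝ => fderiv ℝ F (a + s • (b - a)) (b - a) :=
    ((hF.continuous_fderiv one_ne_zero).comp (by fun_prop)).clm_apply continuous_const
  have h := intervalIntegral.integral_eq_sub_of_hasDerivAt (a := 0) (b := 1) (fun s _ => hd s)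
    (hc.intervalIntegrable _ _)
  simp only [one_smul, zero_smul, add_zero, add_sub_cancel] at h
  rw [← h, intervalIntegral.integral_of_le zero_le_one]
  refine (enorm_integral_le_lintegral_enorm _).trans (lintegral_mono fun s => ?_)
  exact ContinuousLinearMap.le_opENorm _ _

variable {E : Type*} [NormedAddCommGroup E] [NormedSpace ℝ E] [FiniteDimensional ℝ E]
  [MeasurableSpace E] [BorelSpace E] (μ : Measure E) [μ.IsAddHaarMeasure]

/-- The integral of `g` over the ball `B(x, r)`, rescaled to the unit ball. -/
noncomputable def ballLIntegral (g : E → ℝ≥0∞) (x : E) (r : ℝ) : ℝ≥0∞ :=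
  ∫⁻ y in Metric.ball 0 1, g (x + r • y) ∂μ

theorem map_const_add_smul (x : E) {r : ℝ} (hr : r ≠ 0) :
    μ.map (fun y => x + r • y) = ENNReal.ofReal |(r ^ Module.finrank ℝ E)⁻¹| • μ := by
  have h : (fun y : E => x + r • y) = (fun y => x + y) ∘ (fun y => r • y) := rfl
  rw [h, ← Measure.map_map (by fun_prop) (by fun_prop), Measure.map_addHaar_smul μ hr,
    Measure.map_smul, map_add_left_eq_self]

/-- Transfers the almost everywhere convergence of mollifications to the points `x + r • y`, for
almost every `y`. -/
theorem quasiMeasurePreserving_const_add_smul (x : E) {r : ℝ} (hr : r ≠ 0) :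
    Measure.QuasiMeasurePreserving (fun y : E => x + r • y) μ μ :=
  ⟨by fun_prop, by
    rw [map_const_add_smul μ x hr]; exact Measure.smul_absolutelyContinuous⟩

theorem ballLIntegral_eq (g : E → ℝ≥0∞) (x : E) {r : ℝ} (hr : 0 < r) :
    ballLIntegral μ g x r =
      ENNReal.ofReal (r ^ (-(Module.finrank ℝ E : ℝ))) * ∫⁻ y in Metric.ball x r, g y ∂μ := by
  let e : E ≃ᵐ E := ((Homeomorph.smulOfNeZero r hr.ne').trans
    (Homeomorph.addLeft x)).toMeasurableEquiv
  have he : ∀ y, e y = x + r • y := fun y => rfl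
  have hmap : μ.map e = ENNReal.ofReal (r ^ (-(Module.finrank ℝ E : ℝ))) • μ := by
    have : (e : E → E) = fun y => x + r • y := funext he
    rw [this, map_const_add_smul μ x hr.ne', abs_of_pos (by positivity), Real.rpow_neg hr.le,
      Real.rpow_natCast]
  rw [← lintegral_indicator measurableSet_ball, ← smul_eq_mul, ← lintegral_smul_measure, ← hmap,
    lintegral_map_equiv, ballLIntegral, ← lintegral_indicator measurableSet_ball]
  refine lintegral_congr fun y => ?_
  have hiff : e y ∈ Metric.ball x r ↔ y ∈ Metric.ball (0 : E) 1 := by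
    rw [he, mem_ball_iff_norm, add_sub_cancel_left, norm_smul, Real.norm_of_nonneg hr.le,
      mem_ball_zero_iff]
    exact mul_lt_iff_lt_one_right hr
  by_cases hy : y ∈ Metric.ball (0 : E) 1
  · rw [Set.indicator_of_mem hy, Set.indicator_of_mem (hiff.2 hy), he]
  · rw [Set.indicator_of_notMem hy, Set.indicator_of_notMem (mt hiff.1 hy)]

theorem ballLIntegral_lt_top {g : E → ℝ≥0∞} (hg : ∫⁻ y, g y ∂μ ≠ ⊤) (x : E) {r : ℝ}
    (hr : 0 < r) : ballLIntegral μ g x r < ⊤ := by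
  rw [ballLIntegral_eq μ g x hr]
  exact ENNReal.mul_lt_top ENNReal.ofReal_lt_top
    ((setLIntegral_le_lintegral _ _).trans_lt hg.lt_top)

/-- Dominated convergence with majorant `g`: the indicators of nearby balls converge off the sphere,
which is a null set. -/
theorem continuousAt_ballLIntegral {g : E → ℝ≥0∞} (hgm : AEMeasurable g μ)
    (hg : ∫⁻ y, g y ∂μ ≠ ⊤) (x : E) {r : ℝ} (hr : 0 < r) :
    ContinuousAt (fun z : E × ℝ => ballLIntegral μ g z.1 z.2) (x, r) := by
  have h1 : ContinuousAt (fun z : E × ℝ => ∫⁻ y in Metric.ball z.1 z.2, g y ∂μ) (x, r) := by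
    simp only [← lintegral_indicator measurableSet_ball]
    refine tendsto_lintegral_filter_of_dominated_convergence' g
      (.of_forall fun z => hgm.indicator measurableSet_ball)
      (.of_forall fun z => .of_forall fun y => Set.indicator_le_self _ _ _) hg ?_
    have hs : ∀ᵐ y ∂μ, y ∉ Metric.sphere x r :=
      measure_eq_zero_iff_ae_notMem.1 (Measure.addHaar_sphere_of_ne_zero μ x hr.ne')
    filter_upwards [hs] with y hy
    have hd : ContinuousAt (fun z : E × ℝ => dist y z.1 - z.2) (x, r) := by fun_prop
    refine tendsto_const_nhds.congr' ?_
    rcases lt_or_gt_of_ne (show dist y x ≠ r from hy) with h | h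
    · filter_upwards [hd.eventually_lt continuousAt_const (sub_neg.2 h)] with z hz
      rw [Set.indicator_of_mem (Metric.mem_ball.2 h),
        Set.indicator_of_mem (Metric.mem_ball.2 (sub_neg.1 hz))]
    · filter_upwards [continuousAt_const.eventually_lt hd (sub_pos.2 h)] with z hz
      rw [Set.indicator_of_notMem, Set.indicator_of_notMem]
      · exact fun h' => absurd (Metric.mem_ball.1 h') (not_lt.2 (sub_pos.1 hz).le)
      · exact fun h' => absurd (Metric.mem_ball.1 h') (not_lt.2 h.le)
  have h2 : ContinuousAt (fun z : E × ℝ => ENNReal.ofReal (z.2 ^ (-(Module.finrank ℝ E : ℝ))))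
      (x, r) :=
    ENNReal.continuous_ofReal.continuousAt.comp
      (continuousAt_snd.rpow_const (Or.inl hr.ne'))
  have h3 : ContinuousAt (fun z : E × ℝ => ENNReal.ofReal (z.2 ^ (-(Module.finrank ℝ E : ℝ))) *
      ∫⁻ y in Metric.ball z.1 z.2, g y ∂μ) (x, r) :=
    ENNReal.Tendsto.mul h2 (Or.inr ((setLIntegral_le_lintegral _ _).trans_lt hg.lt_top).ne)
      h1 (Or.inr ENNReal.ofReal_ne_top)
  refine h3.congr ?_
  filter_upwards [continuousAt_snd.eventually (lt_mem_nhds hr)] with z hz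
  exact (ballLIntegral_eq μ g z.1 hz).symm

end BallAverages

/-! ### Increments of rescaled functions in terms of the weak gradient. -/

section WeakGradient

variable {n : ℕ} {Ω : Set (EuclideanSpace ℝ (Fin n))} {f : EuclideanSpace ℝ (Fin n) → ℝ}
  {g : EuclideanSpace ℝ (Fin n) → EuclideanSpace ℝ (Fin n)}

theorem MeasureTheory.LocallyIntegrableOn.integrableOn_mul_continuous {u ψ : EuclideanSpace ℝ (Fin n) → ℝ}
    (hu : LocallyIntegrableOn u Ω volume) (hψ : Continuous ψ) (hc : HasCompactSupport ψ)
    (hsub : tsupport ψ ⊆ Ω) : IntegrableOn (fun x => u x * ψ x) Ω volume := by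
  have hu' : IntegrableOn u (tsupport ψ) volume := hu.integrableOn_compact_subset hsub hc
  have h3 : IntegrableOn (fun x => u x * ψ x) (tsupport ψ) volume :=
    hu'.mul_continuousOn hψ.continuousOn hc
  refine ((integrableOn_iff_integrable_of_support_subset ?_).1 h3).integrableOn
  intro x hx
  refine subset_tsupport ψ fun h0 => hx (by simp [h0])

theorem MeasureTheory.LocallyIntegrableOn.euclideanSpace_apply (hg : LocallyIntegrableOn g Ω volume) (i : Fin n) :
    LocallyIntegrableOn (fun x => g x i) Ω volume := by
  intro x hx
  obtain ⟨s, hs, hgs⟩ := hg x hx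
  exact ⟨s, hs, (EuclideanSpace.proj (𝕜 := ℝ) i).integrable_comp hgs⟩

theorem HasWeakGradient.integral_fderiv_eq (h : HasWeakGradient Ω f g)
    {ψ : EuclideanSpace ℝ (Fin n) → ℝ} (hψ : ContDiff ℝ ∞ ψ) (hc : HasCompactSupport ψ)
    (hsub : tsupport ψ ⊆ Ω) (v : EuclideanSpace ℝ (Fin n)) :
    ∫ x in Ω, f x * fderiv ℝ ψ x v = - ∫ x in Ω, inner ℝ (g x) v * ψ x := by
  have hv : v = ∑ i, v i • EuclideanSpace.single i (1 : ℝ) := by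
    ext j
    simp [Finset.sum_apply, Pi.single_apply]
  have h1 : ∀ x, f x * fderiv ℝ ψ x v =
      ∑ i, v i * (f x * fderiv ℝ ψ x (EuclideanSpace.single i 1)) := by
    intro x
    conv_lhs => rw [hv]
    rw [map_sum, Finset.mul_sum]
    refine Finset.sum_congr rfl fun i _ => ?_
    rw [map_smul, smul_eq_mul]; ring
  have h2 : ∀ x, inner ℝ (g x) v * ψ x = ∑ i, v i * (g x i * ψ x) := by
    intro x
    rw [PiLp.inner_apply, Finset.sum_mul]
    refine Finset.sum_congr rfl fun i _ => ?_
    simp; ring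
  simp only [h1, h2]
  rw [integral_finsetSum, integral_finsetSum, ← Finset.sum_neg_distrib]
  · refine Finset.sum_congr rfl fun i _ => ?_
    rw [integral_const_mul, integral_const_mul, h.integral_eq ψ hψ hc hsub i, mul_neg]
  · intro i _
    exact (h.locallyIntegrableOn_grad.euclideanSpace_apply i
      |>.integrableOn_mul_continuous hψ.continuous hc hsub).const_mul _
  · intro i _
    refine (h.locallyIntegrableOn.integrableOn_mul_continuous
      ((hψ.continuous_fderiv (by simp)).clm_apply continuous_const)
      (hc.fderiv_apply ℝ _) ((tsupport_fderiv_apply_subset ℝ _).trans hsub)).const_mul _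

-- The derivative of the mollification falls on the kernel, and `z ↦ ρ (x - z)` is a test function
-- supported in the given closed ball. The definition of the weak gradient moves the derivative onto
-- `g`, so only the inclusion of this one ball in `Ω` matters.
open scoped Convolution in
theorem HasWeakGradient.enorm_fderiv_convolution_le (h : HasWeakGradient Ω f g)
    (hf : LocallyIntegrable f volume) (φ : ContDiffBump (0 : EuclideanSpace ℝ (Fin n)))
    {x : EuclideanSpace ℝ (Fin n)} (hx : Metric.closedBall x φ.rOut ⊆ Ω) :
    ‖fderiv ℝ (φ.normed volume ⋆[ContinuousLinearMap.lsmul ℝ ℝ, volume] f) x‖ₑ ≤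
      ∫⁻ t, ENNReal.ofReal (φ.normed volume t) * ‖g (x - t)‖ₑ := by
  set ρ := φ.normed (volume : Measure (EuclideanSpace ℝ (Fin n))) with hρ
  have hρs : ContDiff ℝ ∞ ρ := φ.contDiff_normed
  have hρc : HasCompactSupport ρ := φ.hasCompactSupport_normed
  have hder := (hρc.hasFDerivAt_convolution_left (ContinuousLinearMap.lsmul ℝ ℝ)
    (hρs.of_le (by simp)) hf x).fderiv
  set I := ∫⁻ t, ENNReal.ofReal (ρ t) * ‖g (x - t)‖ₑ with hI
  -- An infinite right side makes the bound void; a finite one can be used as a real operator-norm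
  -- bound.
  by_cases hItop : I = ⊤
  · rw [hItop]; exact le_top
  set ψ : EuclideanSpace ℝ (Fin n) → ℝ := fun z => ρ (x - z) with hψ
  have hψs : ContDiff ℝ ∞ ψ := hρs.comp (contDiff_const.sub contDiff_id)
  have hψsub : tsupport ψ ⊆ Metric.closedBall x φ.rOut := by
    refine closure_minimal (fun z hz => ?_) Metric.isClosed_closedBall
    have h1 : x - z ∈ Function.support ρ := hz
    rw [hρ, φ.support_normed_eq, mem_ball_zero_iff] at h1
    rw [mem_closedBall_iff_norm']; exact h1.le
  have hψc : HasCompactSupport ψ :=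
    (isCompact_closedBall x φ.rOut).of_isClosed_subset (isClosed_tsupport _) hψsub
  have hψd : ∀ z v, fderiv ℝ ψ z v = - fderiv ℝ ρ (x - z) v := by
    intro z v
    have h1 : HasFDerivAt (fun z => x - z) (-(ContinuousLinearMap.id ℝ _)) z :=
      (hasFDerivAt_id z).const_sub x
    have := (hρs.differentiable (by simp) (x - z)).hasFDerivAt.comp z h1
    rw [show fderiv ℝ ψ z = _ from this.fderiv]
    simp
  have hzero : ∀ z, z ∉ Ω → ψ z = 0 := fun z hz =>
    by_contra fun h0 => hz (hx (hψsub (subset_tsupport ψ h0)))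
  have key : ∀ v, fderiv ℝ (ρ ⋆[ContinuousLinearMap.lsmul ℝ ℝ, volume] f) x v =
      ∫ z in Ω, inner ℝ (g z) v * ψ z := by
    intro v
    have hint : Integrable (fun t => (ContinuousLinearMap.lsmul ℝ ℝ).precompL
        (EuclideanSpace ℝ (Fin n)) (fderiv ℝ ρ t) (f (x - t))) :=
      (hρc.fderiv ℝ).convolutionExists_left _ (hρs.continuous_fderiv (by simp)) hf x
    have hcalc := h.integral_fderiv_eq hψs hψc (hψsub.trans hx) v
    rw [setIntegral_eq_integral_of_forall_compl_eq_zero] at hcalc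
    · rw [hder, convolution, ContinuousLinearMap.integral_apply hint,
        ← neg_eq_iff_eq_neg.2 hcalc, ← integral_sub_left_eq_self _ volume x, ← integral_neg]
      refine integral_congr_ae (.of_forall fun z => ?_)
      simp only [hψd, sub_sub_cancel, ContinuousLinearMap.precompL_apply, ContinuousLinearMap.lsmul_apply, smul_eq_mul]
      ring
    · intro z hz
      have : z ∉ tsupport (fderiv ℝ ψ) := fun h' => hz (hx (hψsub (tsupport_fderiv_subset ℝ h')))
      rw [image_eq_zero_of_notMem_tsupport this]; simp
  have hb : ∀ v, ‖fderiv ℝ (ρ ⋆[ContinuousLinearMap.lsmul ℝ ℝ, volume] f) x v‖ₑ ≤ I * ‖v‖ₑ := by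
    intro v
    rw [key v]
    calc _ ≤ ∫⁻ z in Ω, ‖inner ℝ (g z) v * ψ z‖ₑ := enorm_integral_le_lintegral_enorm _
      _ ≤ ∫⁻ z, ‖inner ℝ (g z) v * ψ z‖ₑ := setLIntegral_le_lintegral _ _
      _ ≤ ∫⁻ z, (ENNReal.ofReal (ρ (x - z)) * ‖g z‖ₑ) * ‖v‖ₑ := by
          refine lintegral_mono fun z => ?_
          have h1 : ‖inner ℝ (g z) v‖ₑ ≤ ‖g z‖ₑ * ‖v‖ₑ := by
            simp only [← ofReal_norm]
            rw [← ENNReal.ofReal_mul (norm_nonneg _)]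
            exact ENNReal.ofReal_le_ofReal (norm_inner_le_norm _ _)
          rw [enorm_mul, Real.enorm_of_nonneg (φ.nonneg_normed _ : 0 ≤ ψ z)]
          calc _ ≤ (‖g z‖ₑ * ‖v‖ₑ) * ENNReal.ofReal (ψ z) := by gcongr
            _ = _ := by ring
      _ = I * ‖v‖ₑ := by
          rw [lintegral_mul_const' _ _ enorm_ne_top, hI,
            ← lintegral_sub_left_eq_self _ x]
          simp only [sub_sub_cancel]
  have hop : ‖fderiv ℝ (ρ ⋆[ContinuousLinearMap.lsmul ℝ ℝ, volume] f) x‖ ≤ I.toReal := by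
    refine ContinuousLinearMap.opNorm_le_bound _ ENNReal.toReal_nonneg fun v => ?_
    have := ENNReal.toReal_mono (ENNReal.mul_ne_top hItop enorm_ne_top) (hb v)
    simpa using this
  rw [← ofReal_norm]
  exact (ENNReal.ofReal_le_ofReal hop).trans ENNReal.ofReal_toReal_le

-- The fundamental theorem of calculus is applied on the segment from `x + r • y` to `x' + r' • y`,
-- whose length is at most `‖x' - x‖ + |r' - r|` because `‖y‖ < 1`. At each time the mollified `‖g‖`
-- is, by Tonelli, a mean of averages of `‖g‖` over balls with shifted centres. The segment and the
-- mollification each move the centre by less than `δ`, whence the `2 * δ` in `hM`; the `4 * δ` in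
-- `hsub` also leaves room for the change of radius.
open scoped Convolution in
theorem HasWeakGradient.lintegral_enorm_convolution_sub_le (h : HasWeakGradient Ω f g)
    (hf : LocallyIntegrable f volume) (hg : Measurable g) {x x' : EuclideanSpace ℝ (Fin n)}
    {r r' δ : ℝ} (hr : 2 * δ < r) (hsub : Metric.ball x (r + 4 * δ) ⊆ Ω)
    {M : ℝ≥0∞} (hM : ∀ ξ ρ, dist ξ x < 2 * δ → |ρ - r| < 2 * δ →
      ballLIntegral volume (fun z => ‖g z‖ₑ) ξ ρ ≤ M)
    (hx' : dist x' x < δ) (hr' : |r' - r| < δ)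
    (φ : ContDiffBump (0 : EuclideanSpace ℝ (Fin n))) (hφ : φ.rOut < δ) :
    ∫⁻ y in Metric.ball 0 1,
      ‖(φ.normed volume ⋆[ContinuousLinearMap.lsmul ℝ ℝ, volume] f) (x' + r' • y) -
        (φ.normed volume ⋆[ContinuousLinearMap.lsmul ℝ ℝ, volume] f) (x + r • y)‖ₑ ≤
      M * ENNReal.ofReal (‖x' - x‖ + |r' - r|) := by
  set F := φ.normed volume ⋆[ContinuousLinearMap.lsmul ℝ ℝ, volume] f with hF
  have hδ : 0 < δ := dist_nonneg.trans_lt hx'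
  have hFs : ContDiff ℝ 1 F := φ.hasCompactSupport_normed.contDiff_convolution_left
    (ContinuousLinearMap.lsmul ℝ ℝ) (φ.contDiff_normed (n := 1)) hf
  have hFc : Continuous fun z => ‖fderiv ℝ F z‖ₑ := (hFs.continuous_fderiv one_ne_zero).enorm
  set L := ENNReal.ofReal (‖x' - x‖ + |r' - r|) with hL
  have harg : ∀ (y : EuclideanSpace ℝ (Fin n)) (s : ℝ),
      x + r • y + s • (x' + r' • y - (x + r • y)) =
        (x + s • (x' - x)) + (r + s * (r' - r)) • y := by
    intro y s; module
  have hdx : ∀ s ∈ Set.Ioc (0 : ℝ) 1, dist (x + s • (x' - x)) x < δ := by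
    intro s hs
    rw [dist_eq_norm, add_sub_cancel_left, norm_smul, Real.norm_of_nonneg hs.1.le]
    rw [dist_eq_norm] at hx'
    nlinarith [norm_nonneg (x' - x), hs.1, hs.2]
  have hdr : ∀ s ∈ Set.Ioc (0 : ℝ) 1, |r + s * (r' - r) - r| < δ := by
    intro s hs
    rw [add_sub_cancel_left, abs_mul, abs_of_pos hs.1]
    nlinarith [abs_nonneg (r' - r), hs.1, hs.2]
  have hmeas : Measurable fun z : EuclideanSpace ℝ (Fin n) × ℝ =>
      ‖fderiv ℝ F ((x + z.2 • (x' - x)) + (r + z.2 * (r' - r)) • z.1)‖ₑ :=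
    (hFc.comp (by fun_prop)).measurable
  have hslice : ∀ s ∈ Set.Ioc (0 : ℝ) 1, ∫⁻ y in Metric.ball (0 : EuclideanSpace ℝ (Fin n)) 1,
      ‖fderiv ℝ F ((x + s • (x' - x)) + (r + s * (r' - r)) • y)‖ₑ ≤ M := by
    intro s hs
    set xs := x + s • (x' - x) with hxs
    set rs := r + s * (r' - r) with hrs
    have h1 := hdx s hs
    have h2 := abs_lt.1 (hdr s hs)
    rw [← hxs] at h1
    rw [← hrs] at h2
    calc ∫⁻ y in Metric.ball (0 : EuclideanSpace ℝ (Fin n)) 1, ‖fderiv ℝ F (xs + rs • y)‖ₑ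
        ≤ ∫⁻ y in Metric.ball (0 : EuclideanSpace ℝ (Fin n)) 1,
            ∫⁻ t, ENNReal.ofReal (φ.normed volume t) * ‖g (xs + rs • y - t)‖ₑ := by
          refine setLIntegral_mono_ae' measurableSet_ball (.of_forall fun y hy => ?_)
          refine h.enorm_fderiv_convolution_le hf φ (subset_trans ?_ hsub)
          intro z hz
          rw [mem_ball_zero_iff] at hy
          rw [Metric.mem_closedBall] at hz
          have h3 : dist (xs + rs • y) xs ≤ r + δ := by
            rw [dist_eq_norm, add_sub_cancel_left, norm_smul, Real.norm_of_nonneg (by linarith)]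
            nlinarith [norm_nonneg y]
          rw [Metric.mem_ball]
          linarith [dist_triangle z (xs + rs • y) x, dist_triangle (xs + rs • y) xs x]
      _ = ∫⁻ t, ∫⁻ y in Metric.ball (0 : EuclideanSpace ℝ (Fin n)) 1,
            ENNReal.ofReal (φ.normed volume t) * ‖g (xs + rs • y - t)‖ₑ := by
          rw [lintegral_lintegral_swap]
          refine Measurable.aemeasurable ?_
          have hρ : Measurable (φ.normed (volume : Measure (EuclideanSpace ℝ (Fin n)))) :=
            (φ.contDiff_normed (n := 1)).continuous.measurable
          exact (hρ.comp measurable_snd).ennreal_ofReal.mul (hg.comp (by fun_prop)).enorm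
      _ ≤ ∫⁻ t, ENNReal.ofReal (φ.normed volume t) * M := by
          refine lintegral_mono fun t => ?_
          dsimp only
          rw [lintegral_const_mul' _ _ ENNReal.ofReal_ne_top]
          by_cases ht : φ.normed volume t = 0
          · simp [ht]
          · have ht' : t ∈ Function.support (φ.normed (volume : Measure (EuclideanSpace ℝ (Fin n)))) :=
              ht
            rw [φ.support_normed_eq, mem_ball_zero_iff] at ht'
            gcongr
            have := hM (xs - t) rs ?_ (abs_lt.2 ⟨by linarith, by linarith⟩)
            · refine le_trans (le_of_eq ?_) this
              simp only [ballLIntegral]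
              refine lintegral_congr fun y => ?_
              rw [sub_add_eq_add_sub]
            · have h4 : dist (xs - t) xs = ‖t‖ := by
                rw [dist_eq_norm, sub_sub_cancel_left, norm_neg]
              linarith [dist_triangle (xs - t) xs x]
      _ = M := by
          rw [lintegral_mul_const, ← ofReal_integral_eq_lintegral_ofReal φ.integrable_normed
            (.of_forall fun t => φ.nonneg_normed t), φ.integral_normed, ENNReal.ofReal_one, one_mul]
          exact (φ.contDiff_normed (n := 1)).continuous.measurable.ennreal_ofReal
  calc _ ≤ ∫⁻ y in Metric.ball (0 : EuclideanSpace ℝ (Fin n)) 1, ∫⁻ s in Set.Ioc (0 : ℝ) 1,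
        ‖fderiv ℝ F ((x + s • (x' - x)) + (r + s * (r' - r)) • y)‖ₑ * L := by
        refine setLIntegral_mono_ae' measurableSet_ball (.of_forall fun y hy => ?_)
        refine (enorm_sub_le_lintegral_fderiv hFs _ _).trans (lintegral_mono fun s => ?_)
        dsimp only
        rw [harg]
        gcongr
        rw [← ofReal_norm, hL]
        apply ENNReal.ofReal_le_ofReal
        rw [show x' + r' • y - (x + r • y) = (x' - x) + (r' - r) • y by module]
        refine (norm_add_le _ _).trans ?_
        rw [norm_smul, Real.norm_eq_abs]
        have := (mem_ball_zero_iff.1 hy).le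
        gcongr
        exact mul_le_of_le_one_right (abs_nonneg _) this
    _ = ∫⁻ s in Set.Ioc (0 : ℝ) 1, (∫⁻ y in Metric.ball (0 : EuclideanSpace ℝ (Fin n)) 1,
        ‖fderiv ℝ F ((x + s • (x' - x)) + (r + s * (r' - r)) • y)‖ₑ) * L := by
        rw [lintegral_lintegral_swap (hmeas.mul_const L).aemeasurable]
        refine lintegral_congr fun s => ?_
        exact lintegral_mul_const' _ _ ENNReal.ofReal_ne_top
    _ ≤ ∫⁻ _ in Set.Ioc (0 : ℝ) 1, M * L := by
        refine setLIntegral_mono_ae' measurableSet_Ioc (.of_forall fun s hs => ?_)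
        gcongr
        exact hslice s hs
    _ = M * L := by simp

/-- The mollified estimate has a bound independent of the mollifier, so Fatou's lemma and almost
everywhere convergence of mollifications remove the smoothing. -/
theorem HasWeakGradient.lintegral_enorm_sub_le (h : HasWeakGradient Ω f g)
    (hf : LocallyIntegrable f volume) (hg : Measurable g) {x x' : EuclideanSpace ℝ (Fin n)}
    {r r' δ : ℝ} (hr : 2 * δ < r) (hsub : Metric.ball x (r + 4 * δ) ⊆ Ω)
    {M : ℝ≥0∞} (hM : ∀ ξ ρ, dist ξ x < 2 * δ → |ρ - r| < 2 * δ →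
      ballLIntegral volume (fun z => ‖g z‖ₑ) ξ ρ ≤ M)
    (hx' : dist x' x < δ) (hr' : |r' - r| < δ) :
    ∫⁻ y in Metric.ball 0 1, ‖f (x' + r' • y) - f (x + r • y)‖ₑ ≤
      M * ENNReal.ofReal (‖x' - x‖ + |r' - r|) := by
  have hδ : 0 < δ := dist_nonneg.trans_lt hx'
  have hr0 : r ≠ 0 := by linarith
  have hr0' : r' ≠ 0 := by linarith [(abs_lt.1 hr').1]
  -- The denominator `k + 2` keeps the outer radius strictly below `δ` already for `k = 0`; the
  -- fixed ratio 2 of outer to inner radius is what the convergence theorem requires.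
  let φ : ℕ → ContDiffBump (0 : EuclideanSpace ℝ (Fin n)) := fun k =>
    ⟨δ / (k + 2) / 2, δ / (k + 2), by positivity, half_lt_self (by positivity)⟩
  have hφlim : Filter.Tendsto (fun k => (φ k).rOut) Filter.atTop (nhds 0) :=
    Filter.Tendsto.div_atTop tendsto_const_nhds
      (Filter.tendsto_atTop_add_const_right _ _ tendsto_natCast_atTop_atTop)
  have hφδ : ∀ k, (φ k).rOut < δ := fun k => by
    change δ / (k + 2) < δ
    rw [div_lt_iff₀ (by positivity)]
    nlinarith [(Nat.cast_nonneg k : (0 : ℝ) ≤ k)]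
  have hae := ContDiffBump.ae_convolution_tendsto_right_of_locallyIntegrable (μ := volume) (K := 2)
    hφlim (.of_forall fun k => by change δ / (k + 2) ≤ 2 * (δ / (k + 2) / 2); linarith) hf
  have h1 := (quasiMeasurePreserving_const_add_smul volume x hr0).ae hae
  have h2 := (quasiMeasurePreserving_const_add_smul volume x' hr0').ae hae
  calc _ = ∫⁻ y in Metric.ball 0 1, Filter.liminf (fun k =>
        ‖(convolution ((φ k).normed volume) f (ContinuousLinearMap.lsmul ℝ ℝ) volume)
            (x' + r' • y) -
          (convolution ((φ k).normed volume) f (ContinuousLinearMap.lsmul ℝ ℝ) volume)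
            (x + r • y)‖ₑ) Filter.atTop := by
        refine lintegral_congr_ae (ae_restrict_of_ae ?_)
        filter_upwards [h1, h2] with y hy1 hy2
        exact (((hy2.sub hy1).enorm).liminf_eq).symm
    _ ≤ _ := lintegral_liminf_le' fun k => ?_
    _ ≤ _ := Filter.liminf_le_of_le (by isBoundedDefault) fun b hb => ?_
  · have hc : Continuous (convolution ((φ k).normed volume) f (ContinuousLinearMap.lsmul ℝ ℝ)
        volume) := ((φ k).hasCompactSupport_normed.contDiff_convolution_left
      (ContinuousLinearMap.lsmul ℝ ℝ) ((φ k).contDiff_normed (n := 1)) hf).continuous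
    exact (((hc.comp (by fun_prop)).sub (hc.comp (by fun_prop))).enorm).measurable.aemeasurable
  · obtain ⟨k, hk⟩ := hb.exists
    exact hk.trans (h.lintegral_enorm_convolution_sub_le hf hg hr hsub hM hx' hr' (φ k) (hφδ k))

end WeakGradient

/-! ### From pointwise slope bounds to increments along segments. -/

section PointwiseSlope

variable {E : Type*} [NormedAddCommGroup E] [NormedSpace ℝ E]

/-- A mean value inequality without differentiability of `φ`: both `φ` and `-φ` are compared with
the primitive of `B`, whose right derivative dominates their upper slopes. -/
theorem abs_sub_le_intervalIntegral_of_eventually_le {φ B : ℝ → ℝ} {h : ℝ} (hh : 0 ≤ h)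
    (hB : ∀ s ∈ Set.Icc 0 h, ContinuousAt B s)
    (hφ : ∀ s ∈ Set.Icc 0 h, ∀ K, B s < K → ∀ᶠ z in nhds s, |φ z - φ s| ≤ K * |z - s|) :
    |φ h - φ 0| ≤ ∫ s in (0 : ℝ)..h, B s := by
  have hint : ∀ s ∈ Set.Icc 0 h, IntervalIntegrable B volume 0 s := fun s hs =>
    ContinuousOn.intervalIntegrable_of_Icc hs.1 fun z hz =>
      (hB z ⟨hz.1, hz.2.trans hs.2⟩).continuousWithinAt
  have hmeas : ∀ s ∈ Set.Ico 0 h, StronglyMeasurableAtFilter B (nhdsWithin s (Set.Ioi s)) := by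
    intro s hs
    refine ⟨Set.Ioo s h, Ioo_mem_nhdsGT hs.2, ?_⟩
    exact ContinuousOn.aestronglyMeasurable
      (fun z hz => (hB z ⟨hs.1.trans hz.1.le, hz.2.le⟩).continuousWithinAt) measurableSet_Ioo
  have hderiv : ∀ s ∈ Set.Ico 0 h,
      HasDerivWithinAt (fun s => ∫ z in (0 : ℝ)..s, B z) (B s) (Set.Ici s) s := fun s hs =>
    intervalIntegral.integral_hasDerivWithinAt_right (hint s ⟨hs.1, hs.2.le⟩) (hmeas s hs)
      (hB s ⟨hs.1, hs.2.le⟩).continuousWithinAt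
  have hcontB : ContinuousOn (fun s => ∫ z in (0 : ℝ)..s, B z) (Set.Icc 0 h) := by
    have := intervalIntegral.continuousOn_primitive_interval (a := (0 : ℝ)) (b := h) (f := B)
      (μ := volume) (by
        rw [Set.uIcc_of_le hh]
        exact ContinuousOn.integrableOn_Icc fun z hz => (hB z hz).continuousWithinAt)
    rwa [Set.uIcc_of_le hh] at this
  have hcont : ContinuousOn φ (Set.Icc 0 h) := by
    intro s hs
    apply ContinuousAt.continuousWithinAt
    rw [ContinuousAt, tendsto_iff_dist_tendsto_zero]
    refine squeeze_zero' (.of_forall fun _ => dist_nonneg)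
      (hφ s hs (B s + 1) (lt_add_one _)) ?_
    have : Continuous fun z : ℝ => (B s + 1) * |z - s| := by fun_prop
    simpa using this.tendsto s
  have main : ∀ σ : ℝ, |σ| = 1 → σ * φ h - σ * φ 0 ≤ ∫ s in (0 : ℝ)..h, B s := by
    intro σ hσ
    have := image_le_of_liminf_slope_right_le_deriv_boundary
      (f := fun s => σ * φ s - σ * φ 0) (a := 0) (b := h)
      ((continuousOn_const.mul hcont).sub continuousOn_const) (by simp) hcontB hderiv ?_
      (Set.right_mem_Icc.2 hh)
    · simpa using this
    · intro s hs K hK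
      obtain ⟨K', hK1, hK2⟩ := exists_between hK
      apply Filter.Eventually.frequently
      filter_upwards [(hφ s ⟨hs.1, hs.2.le⟩ K' hK1).filter_mono nhdsWithin_le_nhds,
        self_mem_nhdsWithin] with z hz hsz
      have hpos : 0 < z - s := sub_pos.2 hsz
      rw [slope_def_field, div_lt_iff₀ hpos]
      rw [abs_of_pos hpos] at hz
      have h1 : σ * φ z - σ * φ 0 - (σ * φ s - σ * φ 0) ≤ |φ z - φ s| := by
        rw [← one_mul |φ z - φ s|, ← hσ, ← abs_mul]
        refine le_trans (le_of_eq ?_) (le_abs_self _)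
        ring
      nlinarith
  rw [abs_le]
  have h1 := main 1 (by simp)
  have h2 := main (-1) (by simp)
  constructor <;> linarith

theorem abs_sub_le_intervalIntegral_segment {Ω : Set E} (hΩ : IsOpen Ω) {u H : E → ℝ}
    (hH : ContinuousOn H Ω) (hH0 : ∀ x ∈ Ω, 0 ≤ H x)
    (hu : ∀ x ∈ Ω, ∀ K, H x < K → ∀ᶠ z in nhds x, |u z - u x| ≤ K * ‖z - x‖)
    {x e : E} (he : ‖e‖ ≤ 1) {h : ℝ} (hh : 0 ≤ h) (hseg : ∀ s ∈ Set.Icc 0 h, x - s • e ∈ Ω) :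
    |u (x - h • e) - u x| ≤ ∫ s in (0 : ℝ)..h, H (x - s • e) := by
  have hγ : Continuous fun s : ℝ => x - s • e := by fun_prop
  have := abs_sub_le_intervalIntegral_of_eventually_le (φ := fun s => u (x - s • e))
    (B := fun s => H (x - s • e)) hh
    (fun s hs => ContinuousAt.comp (hH.continuousAt (hΩ.mem_nhds (hseg s hs))) hγ.continuousAt) ?_
  · simpa using this
  · intro s hs K hK
    filter_upwards [hγ.continuousAt.eventually (hu _ (hseg s hs) K hK)] with z hz
    refine hz.trans (mul_le_mul_of_nonneg_left ?_ ((hH0 _ (hseg s hs)).trans hK.le))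
    rw [show x - z • e - (x - s • e) = (s - z) • e by module, norm_smul, Real.norm_eq_abs,
      abs_sub_comm]
    exact mul_le_of_le_one_right (abs_nonneg _) he

/-- Two one-sided inequalities in `ℝ≥0∞` rather than a bound on a difference: this form is preserved
by suprema, even before these are known to be finite. -/
theorem enorm_le_add_lintegral_segment {Ω : Set E} (hΩ : IsOpen Ω) {u H : E → ℝ}
    (hH : ContinuousOn H Ω) (hH0 : ∀ x ∈ Ω, 0 ≤ H x)
    (hu : ∀ x ∈ Ω, ∀ K, H x < K → ∀ᶠ z in nhds x, |u z - u x| ≤ K * ‖z - x‖)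
    {x e : E} (he : ‖e‖ ≤ 1) {h : ℝ} (hh : 0 ≤ h) (hseg : ∀ s ∈ Set.Icc 0 h, x - s • e ∈ Ω) :
    ENNReal.ofReal (u x) ≤ ENNReal.ofReal (u (x - h • e)) +
        ∫⁻ s in Set.Ioc 0 h, ENNReal.ofReal (H (x - s • e)) ∧
      ENNReal.ofReal (u (x - h • e)) ≤ ENNReal.ofReal (u x) +
        ∫⁻ s in Set.Ioc 0 h, ENNReal.ofReal (H (x - s • e)) := by
  have hγ : Continuous fun s : ℝ => x - s • e := by fun_prop
  have hint : IntegrableOn (fun s => H (x - s • e)) (Set.Ioc 0 h) :=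
    (ContinuousOn.integrableOn_Icc (hH.comp hγ.continuousOn hseg)).mono_set
      Set.Ioc_subset_Icc_self
  have key := abs_sub_le_intervalIntegral_segment hΩ hH hH0 hu he hh hseg
  rw [intervalIntegral.integral_of_le hh] at key
  rw [← ofReal_integral_eq_lintegral_ofReal hint
    ((ae_restrict_iff' measurableSet_Ioc).2 (.of_forall fun s hs => hH0 _ (hseg s ⟨hs.1.le, hs.2⟩)))]
  rw [abs_le] at key
  constructor
  · refine le_trans (ENNReal.ofReal_le_ofReal ?_) ENNReal.ofReal_add_le
    linarith
  · refine le_trans (ENNReal.ofReal_le_ofReal ?_) ENNReal.ofReal_add_le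
    linarith

end PointwiseSlope

/-! ### Slope of weighted averages in centre and radius. -/

section WeightedAverages

variable {n : ℕ} {Ω : Set (EuclideanSpace ℝ (Fin n))} {f : EuclideanSpace ℝ (Fin n) → ℝ}
  {g : EuclideanSpace ℝ (Fin n) → EuclideanSpace ℝ (Fin n)}

/-- Averages of `‖g‖` are continuous, so they stay below `K` near `(x, r)`; the increment estimate
for `f` and the triangle inequality then apply. -/
theorem HasWeakGradient.eventually_abs_ballLIntegral_sub_le (h : HasWeakGradient Ω f g)
    (hfm : Measurable f) (hf : ∫⁻ y, ‖f y‖ₑ ≠ ⊤) (hg : Measurable g) (hgi : ∫⁻ y, ‖g y‖ₑ ≠ ⊤)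
    {x : EuclideanSpace ℝ (Fin n)} {r R : ℝ} (hr : 0 < r) (hrR : r < R)
    (hsub : Metric.ball x R ⊆ Ω) {K : ℝ}
    (hK : (ballLIntegral volume (fun y => ‖g y‖ₑ) x r).toReal < K) :
    ∀ᶠ z in nhds (x, r), |(ballLIntegral volume (fun y => ‖f y‖ₑ) z.1 z.2).toReal -
      (ballLIntegral volume (fun y => ‖f y‖ₑ) x r).toReal| ≤ K * (‖z.1 - x‖ + |z.2 - r|) := by
  have hK0 : 0 < K := ENNReal.toReal_nonneg.trans_lt hK
  have hfi : Integrable f := ⟨hfm.aestronglyMeasurable, hf.lt_top⟩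
  have hlt : ballLIntegral volume (fun y => ‖g y‖ₑ) x r < ENNReal.ofReal K :=
    (ENNReal.lt_ofReal_iff_toReal_lt (ballLIntegral_lt_top volume hgi x hr).ne).2 hK
  have hev := (continuousAt_ballLIntegral volume hg.enorm.aemeasurable hgi x hr).eventually_lt
    continuousAt_const hlt
  obtain ⟨ε, hε, hball⟩ := Metric.eventually_nhds_iff.1 hev
  -- The three conditions keep the perturbed balls where the average of `‖g‖` is below `K`, keep
  -- their radii positive, and keep the enlarged ball inside `Ω`.
  obtain ⟨δ, hδ0, hδ⟩ : ∃ δ > 0, 2 * δ < ε ∧ 2 * δ < r ∧ 4 * δ < R - r := by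
    refine ⟨min ε (min r (R - r)) / 5, by have := sub_pos.2 hrR; positivity, ?_⟩
    have h1 := min_le_left ε (min r (R - r))
    have h2 := (min_le_right ε (min r (R - r))).trans (min_le_left _ _)
    have h3 := (min_le_right ε (min r (R - r))).trans (min_le_right _ _)
    have h4 : 0 < min ε (min r (R - r)) := by have := sub_pos.2 hrR; positivity
    refine ⟨?_, ?_, ?_⟩ <;> linarith
  filter_upwards [Metric.ball_mem_nhds (x, r) hδ0] with z hz
  obtain ⟨hz1, hz2⟩ := max_lt_iff.1 (Metric.mem_ball.1 hz)
  rw [Real.dist_eq] at hz2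
  have hz2' : 0 < z.2 := by linarith [(abs_lt.1 hz2).1]
  have hdiff := h.lintegral_enorm_sub_le hfi.locallyIntegrable hg hδ.2.1
    ((Metric.ball_subset_ball (by linarith)).trans hsub) (M := ENNReal.ofReal K)
    (fun ξ ρ h1 h2 => (hball (y := (ξ, ρ)) (max_lt (h1.trans hδ.1)
      ((Real.dist_eq _ _).trans_lt (h2.trans hδ.1)))).le) hz1 hz2
  rw [← ENNReal.ofReal_mul hK0.le] at hdiff
  set D := ∫⁻ y in Metric.ball (0 : EuclideanSpace ℝ (Fin n)) 1,
    ‖f (z.1 + z.2 • y) - f (x + r • y)‖ₑ with hD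
  have hmeas : ∀ (a : EuclideanSpace ℝ (Fin n)) (s : ℝ), Measurable fun y => ‖f (a + s • y)‖ₑ :=
    fun a s => (hfm.comp (by fun_prop)).enorm
  have h1 : ballLIntegral volume (fun y => ‖f y‖ₑ) z.1 z.2 ≤
      ballLIntegral volume (fun y => ‖f y‖ₑ) x r + D := by
    simp only [ballLIntegral, hD]
    rw [← lintegral_add_left (hmeas x r)]
    refine lintegral_mono fun y => ?_
    calc ‖f (z.1 + z.2 • y)‖ₑ = ‖f (x + r • y) + (f (z.1 + z.2 • y) - f (x + r • y))‖ₑ := by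
          rw [add_sub_cancel]
      _ ≤ _ := enorm_add_le _ _
  have h2 : ballLIntegral volume (fun y => ‖f y‖ₑ) x r ≤
      ballLIntegral volume (fun y => ‖f y‖ₑ) z.1 z.2 + D := by
    simp only [ballLIntegral, hD]
    rw [← lintegral_add_left (hmeas z.1 z.2)]
    refine lintegral_mono fun y => ?_
    calc ‖f (x + r • y)‖ₑ = ‖f (z.1 + z.2 • y) - (f (z.1 + z.2 • y) - f (x + r • y))‖ₑ := by
          rw [sub_sub_cancel]
      _ ≤ _ := enorm_sub_le
  have t1 := (ballLIntegral_lt_top volume hf x hr).ne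
  have t2 := (ballLIntegral_lt_top volume hf z.1 hz2').ne
  have hc : 0 ≤ K * (‖z.1 - x‖ + |z.2 - r|) := by positivity
  have e1 := ENNReal.toReal_mono (by finiteness) (h1.trans (add_le_add le_rfl hdiff))
  have e2 := ENNReal.toReal_mono (by finiteness) (h2.trans (add_le_add le_rfl hdiff))
  rw [ENNReal.toReal_add t1 (by finiteness), ENNReal.toReal_ofReal hc] at e1
  rw [ENNReal.toReal_add t2 (by finiteness), ENNReal.toReal_ofReal hc] at e2
  rw [abs_le]
  constructor <;> linarith

/-- The product rule at the level of pointwise slopes. -/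
theorem HasWeakGradient.eventually_abs_mul_ballLIntegral_sub_le (h : HasWeakGradient Ω f g)
    (hfm : Measurable f) (hf : ∫⁻ y, ‖f y‖ₑ ≠ ⊤) (hg : Measurable g) (hgi : ∫⁻ y, ‖g y‖ₑ ≠ ⊤)
    {x : EuclideanSpace ℝ (Fin n)} {r R : ℝ} (hr : 0 < r) (hrR : r < R)
    (hsub : Metric.ball x R ⊆ Ω) {w : ℝ → ℝ} {w' : ℝ} (hw : HasDerivAt w w' r) {K : ℝ}
    (hK : |w'| * (ballLIntegral volume (fun y => ‖f y‖ₑ) x r).toReal +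
      |w r| * (ballLIntegral volume (fun y => ‖g y‖ₑ) x r).toReal < K) :
    ∀ᶠ z in nhds (x, r), |w z.2 * (ballLIntegral volume (fun y => ‖f y‖ₑ) z.1 z.2).toReal -
      w r * (ballLIntegral volume (fun y => ‖f y‖ₑ) x r).toReal| ≤
        K * (‖z.1 - x‖ + |z.2 - r|) := by
  set A := (ballLIntegral volume (fun y => ‖f y‖ₑ) x r).toReal with hA
  set G := (ballLIntegral volume (fun y => ‖g y‖ₑ) x r).toReal with hG
  have hA0 : 0 ≤ A := ENNReal.toReal_nonneg
  have hG0 : 0 ≤ G := ENNReal.toReal_nonneg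
  -- The strict inequality `hK` leaves room for an error `η` in each factor.
  obtain ⟨η, hη, hη0⟩ : ∃ η : ℝ, (|w'| + η) * A + (|w r| + η) * (G + η) < K ∧ 0 < η := by
    have hc : Continuous fun η : ℝ => (|w'| + η) * A + (|w r| + η) * (G + η) := by fun_prop
    have h1 := (hc.tendsto 0).eventually (gt_mem_nhds (by simpa using hK))
    exact ((h1.filter_mono nhdsWithin_le_nhds).and self_mem_nhdsWithin).exists
      (f := nhdsWithin (0 : ℝ) (Set.Ioi 0))
  have e1 := h.eventually_abs_ballLIntegral_sub_le hfm hf hg hgi hr hrR hsub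
    (K := G + η) (lt_add_of_pos_right _ hη0)
  have e2 : ∀ᶠ s in nhds r, |w s| < |w r| + η :=
    hw.continuousAt.abs.eventually (gt_mem_nhds (lt_add_of_pos_right _ hη0))
  have e3 := (hasDerivAt_iff_isLittleO.1 hw).def hη0
  have hsnd : Filter.Tendsto (Prod.snd : EuclideanSpace ℝ (Fin n) × ℝ → ℝ) (nhds (x, r)) (nhds r) :=
    continuousAt_snd
  filter_upwards [e1, hsnd.eventually e2, hsnd.eventually e3] with z h1 h2 h3
  set Az := (ballLIntegral volume (fun y => ‖f y‖ₑ) z.1 z.2).toReal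
  have h4 : |w z.2 - w r| ≤ (|w'| + η) * |z.2 - r| := by
    rw [Real.norm_eq_abs, Real.norm_eq_abs, smul_eq_mul] at h3
    calc |w z.2 - w r| = |(w z.2 - w r - (z.2 - r) * w') + (z.2 - r) * w'| := by ring_nf
      _ ≤ |w z.2 - w r - (z.2 - r) * w'| + |(z.2 - r) * w'| := abs_add_le _ _
      _ ≤ _ := by rw [abs_mul (z.2 - r)]; linarith
  set L := ‖z.1 - x‖ + |z.2 - r| with hL
  have hL0 : 0 ≤ L := by positivity
  have hL1 : |z.2 - r| ≤ L := by rw [hL]; linarith [norm_nonneg (z.1 - x)]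
  calc |w z.2 * Az - w r * A| = |(w z.2 - w r) * A + w z.2 * (Az - A)| := by ring_nf
    _ ≤ |w z.2 - w r| * A + |w z.2| * |Az - A| := by
        refine (abs_add_le _ _).trans ?_
        rw [abs_mul, abs_mul, abs_of_nonneg hA0]
    _ ≤ (|w'| + η) * L * A + (|w r| + η) * ((G + η) * L) := by
        gcongr
        exact h4.trans (by gcongr)
    _ = ((|w'| + η) * A + (|w r| + η) * (G + η)) * L := by ring
    _ ≤ K * L := by gcongr

end WeightedAverages

/-! ### Representation of functionals bounded by an `L¹` norm. -/

section Duality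

/-- A linear functional on a space of square-integrable functions which is bounded by the `L¹`-norm
is given by integration against a function bounded by `1`. -/
theorem exists_forall_eq_integral_of_abs_le {X : Type*} [MeasurableSpace X] {μ : Measure X}
    [IsFiniteMeasure μ] (V : Submodule ℝ (X → ℝ)) (hV : ∀ ψ ∈ V, MemLp ψ 2 μ) (l : V →ₗ[ℝ] ℝ)
    (hl : ∀ ψ : V, |l ψ| ≤ ∫ x, |(ψ : X → ℝ) x| ∂μ) :
    ∃ v : X → ℝ, Measurable v ∧ (∀ᵐ x ∂μ, |v x| ≤ 1) ∧
      ∀ ψ : V, l ψ = ∫ x, v x * (ψ : X → ℝ) x ∂μ := by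
  have hV1 : ∀ ψ : V, MemLp (ψ : X → ℝ) 1 μ := fun ψ => (hV ψ ψ.2).mono_exponent (by norm_num)
  let T : V →ₗ[ℝ] Lp ℝ 1 μ :=
    { toFun := fun ψ => (hV1 ψ).toLp
      map_add' := fun ψ₁ ψ₂ => MemLp.toLp_add (hV1 ψ₁) (hV1 ψ₂)
      map_smul' := fun c ψ => MemLp.toLp_const_smul c (hV1 ψ) }
  have hTnorm : ∀ ψ : V, ‖T ψ‖ = ∫ x, |(ψ : X → ℝ) x| ∂μ := fun ψ => by
    rw [L1.norm_eq_integral_norm]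
    exact integral_congr_ae ((MemLp.coeFn_toLp (hV1 ψ)).mono fun x hx => by
      dsimp only; rw [← Real.norm_eq_abs, ← hx]; rfl)
  -- The `L¹` bound makes `l` depend only on almost everywhere classes, so it descends to the image
  -- of `V` in `L¹`, where Hahn–Banach extends it with norm at most 1.
  have hker : LinearMap.ker T ≤ LinearMap.ker l := by
    intro ψ hψ
    rw [LinearMap.mem_ker] at hψ ⊢
    have := hl ψ
    rw [← hTnorm, hψ, norm_zero] at this
    exact abs_nonpos_iff.1 this
  let l₀ : LinearMap.range T →ₗ[ℝ] ℝ :=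
    ((LinearMap.ker T).liftQ l hker).comp T.quotKerEquivRange.symm.toLinearMap
  have hl₀ : ∀ ψ : V, l₀ ⟨T ψ, LinearMap.mem_range_self T ψ⟩ = l ψ := by
    intro ψ
    have : T.quotKerEquivRange.symm ⟨T ψ, LinearMap.mem_range_self T ψ⟩ =
        (LinearMap.ker T).mkQ ψ := T.quotKerEquivRange_symm_apply_image ψ _
    simp [l₀, this]
  let l₁ : StrongDual ℝ (LinearMap.range T) := l₀.mkContinuous 1 (by
    rintro ⟨_, ψ, rfl⟩
    rw [hl₀ ψ, one_mul, Real.norm_eq_abs]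
    exact (hl ψ).trans (hTnorm ψ).ge)
  obtain ⟨G, hG, hGnorm⟩ := exists_extension_norm_eq (LinearMap.range T) l₁
  have hG1 : ‖G‖ ≤ 1 := hGnorm.le.trans (LinearMap.mkContinuous_norm_le _ zero_le_one _)
  have hmem : ∀ φ : Lp ℝ 2 μ, MemLp φ 1 μ := fun φ => (Lp.memLp φ).mono_exponent (by norm_num)
  let J₀ : Lp ℝ 2 μ →ₗ[ℝ] Lp ℝ 1 μ :=
    { toFun := fun φ => (hmem φ).toLp
      map_add' := fun φ₁ φ₂ => by
        rw [← MemLp.toLp_add]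
        exact (MemLp.toLp_eq_toLp_iff (hmem _) _).2 (Lp.coeFn_add φ₁ φ₂)
      map_smul' := fun c φ => by
        rw [RingHom.id_apply, ← MemLp.toLp_const_smul]
        exact (MemLp.toLp_eq_toLp_iff (hmem _) _).2 (Lp.coeFn_smul c φ) }
  have hJ : ∀ φ, J₀ φ = (hmem φ).toLp := fun _ => rfl
  let J : Lp ℝ 2 μ →L[ℝ] Lp ℝ 1 μ := J₀.mkContinuous
    (μ Set.univ ^ (1 / (1 : ℝ≥0∞).toReal - 1 / (2 : ℝ≥0∞).toReal)).toReal (by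
      intro φ
      rw [hJ, Lp.norm_toLp, Lp.norm_def, ← ENNReal.toReal_mul, mul_comm]
      refine ENNReal.toReal_mono (ENNReal.mul_ne_top (Lp.eLpNorm_ne_top φ)
        (ENNReal.rpow_ne_top_of_nonneg (by norm_num) (measure_ne_top _ _))) ?_
      exact eLpNorm_le_eLpNorm_mul_rpow_measure_univ (by norm_num) (Lp.aestronglyMeasurable φ))
  -- On a finite measure space `L²` embeds in `L¹`, so the Riesz theorem in `L²` represents the
  -- extension. Testing against indicators then gives `|v₀| ≤ 1` almost everywhere.
  let v₀ : Lp ℝ 2 μ := (InnerProductSpace.toDual ℝ (Lp ℝ 2 μ)).symm (G.comp J)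
  have hv₀ : ∀ φ, inner ℝ v₀ φ = G (J φ) := fun φ => by
    rw [InnerProductSpace.toDual_symm_apply]; rfl
  have hv₀i : Integrable v₀ μ := (Lp.memLp v₀).integrable (by norm_num)
  have hset : ∀ s, MeasurableSet s → |∫ x in s, v₀ x ∂μ| ≤ μ.real s := by
    intro s hs
    have h1 := L2.inner_indicatorConstLp_one (𝕜 := ℝ) hs (measure_ne_top μ s) v₀
    rw [real_inner_comm, hv₀] at h1
    rw [← h1, ← Real.norm_eq_abs]
    refine (G.le_of_opNorm_le hG1 _).trans ?_
    rw [one_mul]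
    change ‖J₀ _‖ ≤ _
    rw [hJ, Lp.norm_toLp, eLpNorm_congr_ae indicatorConstLp_coeFn,
      eLpNorm_indicator_const hs (by norm_num) (by norm_num)]
    simp [Measure.real]
  have hint1 : ∀ s, ∫ x in s, (1 : ℝ) ∂μ = μ.real s := fun s => by simp
  have hle : v₀ ≤ᵐ[μ] fun _ => (1 : ℝ) :=
    ae_le_of_forall_setIntegral_le hv₀i (integrable_const 1) fun s hs _ => by
      rw [hint1]; exact (le_abs_self _).trans (hset s hs)
  have hge : (fun _ => (-1 : ℝ)) ≤ᵐ[μ] v₀ :=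
    ae_le_of_forall_setIntegral_le (integrable_const (-1)) hv₀i fun s hs _ => by
      rw [integral_neg, hint1]; exact (abs_le.1 (hset s hs)).1
  have hsm := (Lp.stronglyMeasurable v₀).measurable
  refine ⟨v₀, hsm, ?_, fun ψ => ?_⟩
  · filter_upwards [hle, hge] with x h1 h2 using abs_le.2 ⟨h2, h1⟩
  · have h1 : J ((hV ψ ψ.2).toLp) = T ψ :=
      (MemLp.toLp_eq_toLp_iff (hmem _) (hV1 ψ)).2 (MemLp.coeFn_toLp (hV ψ ψ.2))
    have h2 := hv₀ ((hV ψ ψ.2).toLp)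
    rw [h1, hG ⟨T ψ, LinearMap.mem_range_self T ψ⟩, L2.inner_def] at h2
    rw [← hl₀ ψ]
    change l₁ _ = _
    rw [← h2]
    refine integral_congr_ae ((MemLp.coeFn_toLp (hV ψ ψ.2)).mono fun x hx => ?_)
    dsimp only
    rw [hx]
    exact mul_comm _ _

end Duality

/-! ### Weak derivatives from bounds against test functions. -/

section WeakDerivative

variable {E : Type*} [NormedAddCommGroup E] [NormedSpace ℝ E]

/-- The smooth functions with compact support in `Ω`. -/
def testFunctions (Ω : Set E) : Submodule ℝ (E → ℝ) where
  carrier := {ψ | ContDiff ℝ ∞ ψ ∧ HasCompactSupport ψ ∧ tsupport ψ ⊆ Ω}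
  add_mem' := by
    rintro ψ₁ ψ₂ ⟨h1, h2, h3⟩ ⟨h4, h5, h6⟩
    exact ⟨h1.add h4, h2.add h5, (tsupport_add ψ₁ ψ₂).trans (Set.union_subset h3 h6)⟩
  zero_mem' := ⟨contDiff_const, HasCompactSupport.zero, by simp [tsupport]⟩
  smul_mem' := by
    rintro c ψ ⟨h1, h2, h3⟩
    exact ⟨contDiff_const.smul h1, h2.smul_left (f := fun _ => c),
      (tsupport_smul_subset_right (fun _ => c) ψ).trans h3⟩

variable [MeasurableSpace E] [BorelSpace E] (μ : Measure E)

/-- The hypothesis says that the distributional derivative is bounded by the `L¹` norm of the finite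
measure `G μ` on `Ω`. Duality represents it by a density of absolute value at most 1 with respect to
that measure; multiplying by `-G` gives the weak derivative. -/
theorem exists_weak_derivative_of_abs_le {Ω : Set E} {F : E → ℝ}
    (hF : IntegrableOn F Ω μ) (e : E) {G : E → ℝ≥0∞} (hG : Measurable G)
    (hGi : ∫⁻ x in Ω, G x ∂μ ≠ ⊤)
    (hb : ∀ ψ ∈ testFunctions Ω, ‖∫ x in Ω, F x * fderiv ℝ ψ x e ∂μ‖ₑ ≤
      ∫⁻ x in Ω, ‖ψ x‖ₑ * G x ∂μ) :
    ∃ v : E → ℝ, Measurable v ∧ (∀ᵐ x ∂μ.restrict Ω, ‖v x‖ₑ ≤ G x) ∧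
      ∀ ψ ∈ testFunctions Ω, ∫ x in Ω, F x * fderiv ℝ ψ x e ∂μ = -∫ x in Ω, v x * ψ x ∂μ := by
  set ν := (μ.restrict Ω).withDensity G with hν
  have : IsFiniteMeasure ν := isFiniteMeasure_withDensity hGi
  have hint : ∀ ψ ∈ testFunctions Ω, Integrable (fun x => F x * fderiv ℝ ψ x e) (μ.restrict Ω) := by
    rintro ψ ⟨h1, h2, -⟩
    have hc : Continuous fun x => fderiv ℝ ψ x e :=
      (h1.continuous_fderiv (by simp)).clm_apply continuous_const
    obtain ⟨C, hC⟩ := hc.bounded_above_of_compact_support (h2.fderiv_apply ℝ e)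
    exact Integrable.mul_bdd (c := C) hF hc.aestronglyMeasurable (.of_forall hC)
  let l : testFunctions Ω →ₗ[ℝ] ℝ :=
    { toFun := fun ψ => ∫ x in Ω, F x * fderiv ℝ (ψ : E → ℝ) x e ∂μ
      map_add' := fun ψ₁ ψ₂ => by
        rw [← integral_add (hint _ ψ₁.2) (hint _ ψ₂.2)]
        refine integral_congr_ae (.of_forall fun x => ?_)
        dsimp only
        rw [Submodule.coe_add, fderiv_add (ψ₁.2.1.differentiable (by simp) x)
          (ψ₂.2.1.differentiable (by simp) x), add_apply, mul_add]
      map_smul' := fun c ψ => by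
        rw [RingHom.id_apply, smul_eq_mul, ← integral_const_mul]
        refine integral_congr_ae (.of_forall fun x => ?_)
        dsimp only
        rw [Submodule.coe_smul, fderiv_const_smul (ψ.2.1.differentiable (by simp) x),
          smul_apply, smul_eq_mul]
        ring }
  have hmem : ∀ ψ ∈ testFunctions Ω, MemLp ψ ⊤ ν := by
    rintro ψ ⟨h1, h2, -⟩
    obtain ⟨C, hC⟩ := h1.continuous.bounded_above_of_compact_support h2
    exact memLp_top_of_bound h1.continuous.aestronglyMeasurable C (.of_forall hC)
  obtain ⟨v, hvm, hv1, hv⟩ := exists_forall_eq_integral_of_abs_le (μ := ν) (testFunctions Ω)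
    (fun ψ hψ => (hmem ψ hψ).mono_exponent le_top) l (fun ψ => by
      have hi : Integrable (ψ : E → ℝ) ν := (hmem ψ ψ.2).integrable le_top
      have h1 := hb ψ ψ.2
      have h2 : ∫⁻ x in Ω, ‖(ψ : E → ℝ) x‖ₑ * G x ∂μ = ∫⁻ x, ‖(ψ : E → ℝ) x‖ₑ ∂ν := by
        rw [hν, lintegral_withDensity_eq_lintegral_mul _ hG
          ψ.2.1.continuous.enorm.measurable]
        simp only [Pi.mul_apply, mul_comm]
      rw [h2] at h1
      have h3 := ENNReal.toReal_mono hi.2.ne h1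
      rw [toReal_enorm, Real.norm_eq_abs, ← integral_norm_eq_lintegral_enorm hi.1] at h3
      exact h3)
  have hGfin : ∀ᵐ x ∂μ.restrict Ω, G x < ⊤ := ae_lt_top hG hGi
  refine ⟨fun x => -((G x).toReal * v x), (hG.ennreal_toReal.mul hvm).neg, ?_, fun ψ hψ => ?_⟩
  · have h1 := (ae_withDensity_iff hG).1 hv1
    filter_upwards [h1, hGfin] with x hx hx'
    rw [enorm_neg, enorm_mul, Real.enorm_of_nonneg ENNReal.toReal_nonneg,
      ENNReal.ofReal_toReal hx'.ne]
    -- The bound on the density holds only almost everywhere for `G μ`, hence says nothing where `G`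
    -- vanishes; there the product is zero anyway.
    by_cases h0 : G x = 0
    · simp [h0]
    · refine mul_le_of_le_one_right zero_le ?_
      rw [Real.enorm_eq_ofReal_abs, ENNReal.ofReal_le_one]
      exact hx h0
  · refine (hv ⟨ψ, hψ⟩).trans ?_
    rw [hν, integral_withDensity_eq_integral_toReal_smul hG hGfin, ← integral_neg]
    refine integral_congr_ae (.of_forall fun x => ?_)
    simp only [smul_eq_mul]
    ring

variable [FiniteDimensional ℝ E] [μ.IsAddHaarMeasure]

/-- If the increments of `F` along segments in `Ω` are controlled by the line integrals of `G`,
then `G` dominates the distributional derivatives of `F`. -/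
theorem enorm_integral_mul_fderiv_le {Ω : Set E} (hΩ : IsOpen Ω) {F G : E → ℝ≥0∞}
    (hF : AEMeasurable F (μ.restrict Ω)) (hFi : ∫⁻ x in Ω, F x ∂μ ≠ ⊤)
    (hG : Measurable G) (hGi : ∫⁻ x in Ω, G x ∂μ ≠ ⊤) {e : E}
    (hFG : ∀ (x : E) (h : ℝ), 0 ≤ h → (∀ s ∈ Set.Icc 0 h, x - s • e ∈ Ω) →
      F x ≤ F (x - h • e) + ∫⁻ s in Set.Ioc 0 h, G (x - s • e) ∧
      F (x - h • e) ≤ F x + ∫⁻ s in Set.Ioc 0 h, G (x - s • e))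
    {ψ : E → ℝ} (hψ : ψ ∈ testFunctions Ω) :
    ‖∫ x in Ω, (F x).toReal * fderiv ℝ ψ x e ∂μ‖ₑ ≤ ∫⁻ x in Ω, ‖ψ x‖ₑ * G x ∂μ := by
  obtain ⟨hψs, hψc, hψΩ⟩ := hψ
  obtain ⟨C, hC⟩ := hψs.lipschitzWith_of_hasCompactSupport hψc (by simp)
  obtain ⟨b, hbd⟩ := hψs.continuous.bounded_above_of_compact_support hψc
  -- Segments shorter than `δ` that start in the support of `ψ` stay in `Ω`, so extending `F` and
  -- `G` by zero does no harm for small steps.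
  obtain ⟨δ, hδ, hδΩ⟩ := hψc.exists_cthickening_subset_open hΩ hψΩ
  set f := Ω.indicator fun x => (F x).toReal with hf
  set g := Ω.indicator G with hg
  have hfi : Integrable f μ := by
    rw [hf, integrable_indicator_iff hΩ.measurableSet]
    exact integrable_toReal_of_lintegral_ne_top hF hFi
  have hgm : Measurable g := hG.indicator hΩ.measurableSet
  have hgi : ∫⁻ x, g x ∂μ ≠ ⊤ := by rwa [hg, lintegral_indicator hΩ.measurableSet]
  have hFfin : ∀ᵐ x ∂μ, x ∈ Ω → F x < ⊤ :=
    (ae_restrict_iff' hΩ.measurableSet).1 (ae_lt_top' hF hFi)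
  set I := ∫⁻ x in Ω, ‖ψ x‖ₑ * G x ∂μ with hI
  have hIg : ∫⁻ x, ‖ψ x‖ₑ * g x ∂μ = I := by
    rw [hI, ← lintegral_indicator hΩ.measurableSet]
    refine lintegral_congr fun x => ?_
    by_cases hx : x ∈ Ω <;> simp [hg, hx]
  set J := ∫⁻ x, g x ∂μ with hJ
  have hshift : ∀ z : E, Integrable (fun x => f x * ψ (x + z)) μ := fun z =>
    Integrable.mul_bdd (c := b) hfi (hψs.continuous.comp (by fun_prop)).aestronglyMeasurable
      (.of_forall fun x => hbd _)
  set h : ℕ → ℝ := fun k => 1 / ((k : ℝ) + 1) with hh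
  have hhpos : ∀ k, 0 < h k := fun k => by positivity
  have hhlim : Filter.Tendsto h Filter.atTop (nhds 0) := tendsto_one_div_add_atTop_nhds_zero_nat
  -- Translation moves the difference quotient from `ψ` to `f`, whose increments are bounded by line
  -- integrals of `g`. Tonelli and translating back place the weight `ψ (x + s • e)` on `g`;
  -- replacing it by `ψ x` costs the Lipschitz error term, which vanishes in the limit.
  have hbound : ∀ᶠ k in Filter.atTop,
      ‖∫ x, f x * ((h k)⁻¹ * (ψ (x + h k • e) - ψ x)) ∂μ‖ₑ ≤
        I + ENNReal.ofReal (C * (h k * ‖e‖)) * J := by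
    have hsmall : ∀ᶠ k in Filter.atTop, h k * ‖e‖ < δ := by
      have : Filter.Tendsto (fun k => h k * ‖e‖) Filter.atTop (nhds 0) := by
        simpa using hhlim.mul_const ‖e‖
      exact this.eventually (gt_mem_nhds hδ)
    filter_upwards [hsmall] with k hk
    set t := h k with ht
    have ht0 : 0 < t := hhpos k
    have hrw : ∫ x, f x * (t⁻¹ * (ψ (x + t • e) - ψ x)) ∂μ =
        t⁻¹ * ∫ x, ψ x * (f (x - t • e) - f x) ∂μ := by
      have h1 : ∫ x, f x * ψ (x + t • e) ∂μ = ∫ x, ψ x * f (x - t • e) ∂μ := by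
        rw [← integral_sub_right_eq_self _ (t • e)]
        refine integral_congr_ae (.of_forall fun x => ?_)
        simp [mul_comm]
      have h2 : Integrable (fun x => f x * ψ x) μ := by simpa using hshift 0
      have h3 : Integrable (fun x => ψ x * f (x - t • e)) μ := by
        have := (hshift (t • e)).comp_sub_right (t • e)
        simpa [mul_comm] using this
      calc _ = t⁻¹ * (∫ x, f x * ψ (x + t • e) ∂μ - ∫ x, f x * ψ x ∂μ) := by
            rw [← integral_sub (hshift _) h2, ← integral_const_mul]
            refine integral_congr_ae (.of_forall fun x => ?_)
            dsimp only; ring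
        _ = t⁻¹ * (∫ x, ψ x * f (x - t • e) ∂μ - ∫ x, f x * ψ x ∂μ) := by rw [h1]
        _ = _ := by
            rw [← integral_sub h3 h2]
            congr 1
            refine integral_congr_ae (.of_forall fun x => ?_)
            dsimp only; ring
    have hpt : ∀ᵐ x ∂μ, ‖ψ x * (f (x - t • e) - f x)‖ₑ ≤
        ‖ψ x‖ₑ * ∫⁻ s in Set.Ioc 0 t, g (x - s • e) := by
      have hFfin' : ∀ᵐ x ∂μ, x - t • e ∈ Ω → F (x - t • e) < ⊤ :=
        (measurePreserving_sub_right μ (t • e)).quasiMeasurePreserving.ae hFfin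
      filter_upwards [hFfin, hFfin'] with x hx1 hx2
      rw [enorm_mul]
      by_cases hx : x ∈ tsupport ψ
      · have hseg : ∀ s ∈ Set.Icc 0 t, x - s • e ∈ Ω := by
          intro s hs
          refine hδΩ (Metric.mem_cthickening_of_dist_le _ x δ _ hx ?_)
          rw [dist_eq_norm, sub_sub_cancel_left, norm_neg, norm_smul, Real.norm_of_nonneg hs.1]
          exact (mul_le_mul_of_nonneg_right hs.2 (norm_nonneg e)).trans hk.le
        have hxΩ := hψΩ hx
        have hxtΩ := hseg t ⟨ht0.le, le_rfl⟩
        obtain ⟨h1, h2⟩ := hFG x t ht0.le hseg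
        have h3 : ∫⁻ s in Set.Ioc 0 t, g (x - s • e) = ∫⁻ s in Set.Ioc 0 t, G (x - s • e) :=
          setLIntegral_congr_fun measurableSet_Ioc fun s hs =>
            Set.indicator_of_mem (hseg s ⟨hs.1.le, hs.2⟩) G
        gcongr
        rw [h3, hf, Set.indicator_of_mem hxΩ, Set.indicator_of_mem hxtΩ]
        set D := ∫⁻ s in Set.Ioc 0 t, G (x - s • e)
        by_cases hD : D = ⊤
        · rw [hD]; exact le_top
        have n1 := (hx1 hxΩ).ne
        have n2 := (hx2 hxtΩ).ne
        have e1 := ENNReal.toReal_mono (by finiteness) h1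
        have e2 := ENNReal.toReal_mono (by finiteness) h2
        rw [ENNReal.toReal_add n2 hD] at e1
        rw [ENNReal.toReal_add n1 hD] at e2
        rw [Real.enorm_eq_ofReal_abs]
        refine ENNReal.ofReal_le_of_le_toReal (abs_le.2 ⟨?_, ?_⟩) <;> linarith
      · rw [image_eq_zero_of_notMem_tsupport hx]; simp
    have hmain : ∫⁻ x, ‖ψ x‖ₑ * (∫⁻ s in Set.Ioc 0 t, g (x - s • e)) ∂μ ≤
        ENNReal.ofReal t * (I + ENNReal.ofReal (C * (t * ‖e‖)) * J) := by
      have hmeas : Measurable fun z : E × ℝ => ‖ψ z.1‖ₑ * g (z.1 - z.2 • e) :=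
        (hψs.continuous.enorm.measurable.comp measurable_fst).mul (hgm.comp (by fun_prop))
      calc _ = ∫⁻ x, (∫⁻ s in Set.Ioc 0 t, ‖ψ x‖ₑ * g (x - s • e)) ∂μ := by
            refine lintegral_congr fun x => ?_
            rw [lintegral_const_mul' _ _ enorm_ne_top]
        _ = ∫⁻ s in Set.Ioc 0 t, (∫⁻ x, ‖ψ x‖ₑ * g (x - s • e) ∂μ) :=
            lintegral_lintegral_swap hmeas.aemeasurable
        _ ≤ ∫⁻ _ in Set.Ioc 0 t, (I + ENNReal.ofReal (C * (t * ‖e‖)) * J) := by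
            refine setLIntegral_mono_ae' measurableSet_Ioc (.of_forall fun s hs => ?_)
            rw [← lintegral_add_right_eq_self _ (s • e), ← hIg, hJ,
              ← lintegral_const_mul' _ _ ENNReal.ofReal_ne_top, ← lintegral_add_right _
              (hgm.const_mul _)]
            refine lintegral_mono fun x => ?_
            dsimp only
            rw [add_sub_cancel_right, ← add_mul]
            gcongr
            have h1 : ‖ψ (x + s • e) - ψ x‖ ≤ C * (t * ‖e‖) := by
              refine (hC.norm_sub_le _ _).trans ?_
              rw [add_sub_cancel_left, norm_smul, Real.norm_of_nonneg hs.1.le]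
              gcongr
              exact hs.2
            calc ‖ψ (x + s • e)‖ₑ = ‖ψ x + (ψ (x + s • e) - ψ x)‖ₑ := by rw [add_sub_cancel]
              _ ≤ ‖ψ x‖ₑ + ‖ψ (x + s • e) - ψ x‖ₑ := enorm_add_le _ _
              _ ≤ _ := by
                gcongr
                rw [← ofReal_norm]
                exact ENNReal.ofReal_le_ofReal h1
        _ = _ := by
            rw [setLIntegral_const, Real.volume_Ioc, sub_zero, mul_comm]
    rw [hrw, enorm_mul, Real.enorm_of_nonneg (inv_pos.2 ht0).le]
    calc _ ≤ ENNReal.ofReal t⁻¹ *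
          (ENNReal.ofReal t * (I + ENNReal.ofReal (C * (t * ‖e‖)) * J)) := by
          gcongr
          exact (enorm_integral_le_lintegral_enorm _).trans ((lintegral_mono_ae hpt).trans hmain)
      _ = _ := by
          rw [← mul_assoc, ← ENNReal.ofReal_mul (inv_pos.2 ht0).le, inv_mul_cancel₀ ht0.ne',
            ENNReal.ofReal_one, one_mul]
  have hlim : Filter.Tendsto (fun k => ∫ x, f x * ((h k)⁻¹ * (ψ (x + h k • e) - ψ x)) ∂μ)
      Filter.atTop (nhds (∫ x, f x * fderiv ℝ ψ x e ∂μ)) := by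
    refine tendsto_integral_of_dominated_convergence (fun x => ‖f x‖ * (C * ‖e‖))
      (fun k => hfi.1.mul ?_) (hfi.norm.mul_const _) (fun k => .of_forall fun x => ?_)
      (.of_forall fun x => Filter.Tendsto.const_mul _ ?_)
    · exact (continuous_const.mul ((hψs.continuous.comp (by fun_prop)).sub
        hψs.continuous)).aestronglyMeasurable
    · rw [norm_mul, norm_mul, norm_inv, Real.norm_of_nonneg (hhpos k).le]
      refine mul_le_mul_of_nonneg_left ?_ (norm_nonneg _)
      rw [inv_mul_le_iff₀ (hhpos k)]
      refine (hC.norm_sub_le _ _).trans ?_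
      rw [add_sub_cancel_left, norm_smul, Real.norm_of_nonneg (hhpos k).le]
      exact le_of_eq (by ring)
    · have hd := (hψs.differentiable (by simp) x).hasFDerivAt.hasLineDerivAt e
      have h1 := hd.tendsto_slope_zero
      exact h1.comp (tendsto_nhdsWithin_iff.2 ⟨hhlim, .of_forall fun k => (hhpos k).ne'⟩)
  have hrhs : Filter.Tendsto (fun k => I + ENNReal.ofReal (C * (h k * ‖e‖)) * J)
      Filter.atTop (nhds I) := by
    have h1 : Filter.Tendsto (fun k => ENNReal.ofReal (C * (h k * ‖e‖))) Filter.atTop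
        (nhds 0) := by
      rw [← ENNReal.ofReal_zero]
      refine ENNReal.tendsto_ofReal ?_
      simpa using (hhlim.mul_const ‖e‖).const_mul (C : ℝ)
    have h2 := ENNReal.Tendsto.mul_const h1 (Or.inr hgi)
    simpa using h2.const_add I
  have hfinal := le_of_tendsto_of_tendsto hlim.enorm hrhs hbound
  refine le_trans (le_of_eq ?_) hfinal
  congr 1
  rw [← integral_indicator hΩ.measurableSet]
  refine integral_congr_ae (.of_forall fun x => ?_)
  by_cases hx : x ∈ Ω <;> simp [hf, hx]

end WeakDerivative

/-! ### The radial weight and its derivative. -/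

section Weight

/-- The factor in front of the integral in `localFracMaximal`, multiplied by `r ^ n`, when the unit
ball has volume `c`. -/
noncomputable def maximalWeight (n : ℕ) (γ β c r : ℝ) : ℝ :=
  r ^ β * ((1 + r ^ n) ^ (γ * β / n) / ((1 + c * r ^ n) ^ γ * c))

/-- The weight is `r ^ β` times a function `k` that is `C¹` near `[0, R]`, so `k` and `k'` are
bounded there. Terms with `r ^ β` are reduced to `r ^ (β - 1)` at the cost of a factor `R`. -/
theorem exists_hasDerivAt_maximalWeight (n : ℕ) (γ : ℝ) {β c : ℝ} (hβ : 1 ≤ β) (hc : 0 < c)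
    {R : ℝ} (hR : 0 ≤ R) :
    ∃ (C : ℝ) (w' : ℝ → ℝ), 0 ≤ C ∧
      (∀ r, 0 < r → HasDerivAt (maximalWeight n γ β c) (w' r) r) ∧
      ∀ r, 0 < r → r ≤ R → |w' r| ≤ C * r ^ (β - 1) ∧ |maximalWeight n γ β c r| ≤ C * r ^ (β - 1) := by
  set k : ℝ → ℝ := fun r => (1 + r ^ n) ^ (γ * β / n) / ((1 + c * r ^ n) ^ γ * c) with hk
  -- An open set containing `[0, R]`, so that the derivative of `k` is continuous up to the endpoint
  -- 0.
  set U : Set ℝ := {r | 0 < 1 + r ^ n} ∩ {r | 0 < 1 + c * r ^ n} with hU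
  have hUo : IsOpen U := (isOpen_lt continuous_const (by fun_prop)).inter
    (isOpen_lt continuous_const (by fun_prop))
  have hUsub : ∀ r, 0 ≤ r → r ∈ U := fun r hr => by
    constructor <;> simp only [Set.mem_ofPred_eq] <;> positivity
  have hkc : ContDiffOn ℝ 1 k U := by
    refine ContDiffOn.div (ContDiffOn.rpow_const_of_ne (by fun_prop) fun r hr => hr.1.ne')
      ((ContDiffOn.rpow_const_of_ne (by fun_prop) fun r hr => hr.2.ne').mul contDiffOn_const)
      fun r hr => ?_
    have : 0 < (1 + c * r ^ n) ^ γ := Real.rpow_pos_of_pos hr.2 _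
    positivity
  have hI : Set.Icc 0 R ⊆ U := fun r hr => hUsub r hr.1
  obtain ⟨K₁, hK₁⟩ := isCompact_Icc.exists_bound_of_continuousOn (hkc.continuousOn.mono hI)
  obtain ⟨K₂, hK₂⟩ := isCompact_Icc.exists_bound_of_continuousOn
    ((hkc.continuousOn_deriv_of_isOpen hUo le_rfl).mono hI)
  have hK₁0 : 0 ≤ K₁ := (norm_nonneg _).trans (hK₁ 0 ⟨le_rfl, hR⟩)
  have hK₂0 : 0 ≤ K₂ := (norm_nonneg _).trans (hK₂ 0 ⟨le_rfl, hR⟩)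
  refine ⟨β * K₁ + R * K₂ + R * K₁, fun r => β * r ^ (β - 1) * k r + r ^ β * deriv k r,
    by positivity, fun r hr => ?_, fun r hr hrR => ?_⟩
  · have h1 : HasDerivAt k (deriv k r) r :=
      ((hkc.contDiffAt (hUo.mem_nhds (hUsub r hr.le))).differentiableAt one_ne_zero).hasDerivAt
    exact (Real.hasDerivAt_rpow_const (Or.inl hr.ne')).mul h1
  · have h1 : |k r| ≤ K₁ := hK₁ r ⟨hr.le, hrR⟩
    have h2 : |deriv k r| ≤ K₂ := hK₂ r ⟨hr.le, hrR⟩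
    have hp : 0 < r ^ (β - 1) := Real.rpow_pos_of_pos hr _
    have hsplit : r ^ β = r ^ (β - 1) * r := by
      rw [← Real.rpow_add_one hr.ne', sub_add_cancel]
    have h3 : |r ^ β * deriv k r| ≤ R * K₂ * r ^ (β - 1) := by
      rw [abs_mul, abs_of_pos (Real.rpow_pos_of_pos hr _), hsplit]
      calc _ ≤ r ^ (β - 1) * R * K₂ := by gcongr
        _ = _ := by ring
    have h4 : |r ^ β * k r| ≤ R * K₁ * r ^ (β - 1) := by
      rw [abs_mul, abs_of_pos (Real.rpow_pos_of_pos hr _), hsplit]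
      calc _ ≤ r ^ (β - 1) * R * K₁ := by gcongr
        _ = _ := by ring
    have h5 : |β * r ^ (β - 1) * k r| ≤ β * K₁ * r ^ (β - 1) := by
      rw [abs_mul, abs_of_pos (by positivity)]
      calc _ ≤ β * r ^ (β - 1) * K₁ := by gcongr
        _ = _ := by ring
    have p1 : 0 ≤ β * K₁ * r ^ (β - 1) := by positivity
    have p2 : 0 ≤ R * K₂ * r ^ (β - 1) := by positivity
    have p3 : 0 ≤ R * K₁ * r ^ (β - 1) := by positivity
    constructor
    · refine (abs_add_le _ _).trans ?_
      linarith
    · change |r ^ β * k r| ≤ _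
      linarith

theorem maximalWeight_nonneg (n : ℕ) (γ β : ℝ) {c r : ℝ} (hc : 0 < c) (hr : 0 ≤ r) :
    0 ≤ maximalWeight n γ β c r := by
  unfold maximalWeight
  positivity

end Weight

/-! ### Distance to the complement and bounded radii. -/

section DistanceToComplement

variable {n : ℕ} {Ω : Set (EuclideanSpace ℝ (Fin n))}

theorem ball_infDist_compl_subset {X : Type*} [PseudoMetricSpace X] (Ω : Set X) (x : X) :
    Metric.ball x (Metric.infDist x Ωᶜ) ⊆ Ω := by
  intro y hy
  by_contra h
  have : Metric.infDist x Ωᶜ ≤ dist x y := Metric.infDist_le_dist_of_mem h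
  rw [Metric.mem_ball, dist_comm] at hy
  linarith

theorem infDist_compl_pos {X : Type*} [PseudoMetricSpace X] {Ω : Set X} (hΩ : IsOpen Ω)
    (hne : Ωᶜ.Nonempty) {x : X} (hx : x ∈ Ω) : 0 < Metric.infDist x Ωᶜ :=
  (hΩ.isClosed_compl.notMem_iff_infDist_pos hne).1 (by simpa using hx)

/-- The volume `c r^n` of a ball in `Ω` is at most `|Ω|`; for `r > 1` the inequality `r ≤ r^n`
avoids taking a root. -/
theorem exists_radius_bound (hn : n ≠ 0) (hfin : volume Ω < ⊤) :
    ∃ R : ℝ, 0 ≤ R ∧ ∀ x r, Metric.ball x r ⊆ Ω → r ≤ R := by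
  set c := volume.real (Metric.ball (0 : EuclideanSpace ℝ (Fin n)) 1) with hc
  have hc0 : 0 < c := ENNReal.toReal_pos (Metric.measure_ball_pos volume _ one_pos).ne'
    measure_ball_lt_top.ne
  refine ⟨max 1 (volume.real Ω / c), le_max_of_le_left zero_le_one, fun x r hsub => ?_⟩
  by_cases hr : r ≤ 1
  · exact hr.trans (le_max_left _ _)
  · push Not at hr
    refine le_trans ?_ (le_max_right _ _)
    have h1 : volume.real (Metric.ball x r) ≤ volume.real Ω := measureReal_mono hsub hfin.ne
    rw [Measure.real, Measure.addHaar_ball_of_pos volume x (by linarith), ENNReal.toReal_mul,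
      ENNReal.toReal_ofReal (by positivity), finrank_euclideanSpace_fin] at h1
    rw [le_div_iff₀ hc0]
    have h2 : r ≤ r ^ n := le_self_pow₀ hr.le hn
    exact (mul_le_mul_of_nonneg_right h2 hc0.le).trans h1

/-- Needed because `Metric.infDist` to the empty set has default value 0, whereas `Metric.infEDist`
is infinite. -/
theorem nonempty_compl_of_radius_bound {R : ℝ} (hR : ∀ x r, Metric.ball x r ⊆ Ω → r ≤ R) :
    Ωᶜ.Nonempty := by
  by_contra h
  rw [Set.not_nonempty_iff_eq_empty, Set.compl_empty_iff] at h
  have := hR 0 (R + 1) (h ▸ Set.subset_univ _)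
  linarith

end DistanceToComplement

/-! ### Averages over balls with radius proportional to the distance. -/

section DilatedAverage

variable {n : ℕ} {Ω : Set (EuclideanSpace ℝ (Fin n))} {f : EuclideanSpace ℝ (Fin n) → ℝ}
  {g : EuclideanSpace ℝ (Fin n) → EuclideanSpace ℝ (Fin n)} {w : ℝ → ℝ}

/-- The weighted average of `|f|` over the ball around `x` whose radius is `t` times the distance to
the complement of `Ω`. -/
noncomputable def dilatedAverage (w : ℝ → ℝ) (Ω : Set (EuclideanSpace ℝ (Fin n)))
    (f : EuclideanSpace ℝ (Fin n) → ℝ) (t : ℝ) (x : EuclideanSpace ℝ (Fin n)) : ℝ :=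
  w (t * Metric.infDist x Ωᶜ) *
    (ballLIntegral volume (fun y => ‖f y‖ₑ) x (t * Metric.infDist x Ωᶜ)).toReal

/-- A continuous bound for the gradient of `dilatedAverage`. -/
noncomputable def dilatedSlope (C a : ℝ) (Ω : Set (EuclideanSpace ℝ (Fin n)))
    (f : EuclideanSpace ℝ (Fin n) → ℝ)
    (g : EuclideanSpace ℝ (Fin n) → EuclideanSpace ℝ (Fin n)) (t : ℝ)
    (x : EuclideanSpace ℝ (Fin n)) : ℝ :=
  2 * (C * (t * Metric.infDist x Ωᶜ) ^ a *
    ((ballLIntegral volume (fun y => ‖f y‖ₑ) x (t * Metric.infDist x Ωᶜ)).toReal +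
      (ballLIntegral volume (fun y => ‖g y‖ₑ) x (t * Metric.infDist x Ωᶜ)).toReal))

theorem tendsto_prodMk_mul_infDist (Ω : Set (EuclideanSpace ℝ (Fin n))) (t : ℝ)
    (x : EuclideanSpace ℝ (Fin n)) :
    Filter.Tendsto (fun z => (z, t * Metric.infDist z Ωᶜ)) (nhds x)
      (nhds (x, t * Metric.infDist x Ωᶜ)) :=
  (continuous_id.prodMk (continuous_const.mul (Metric.continuous_infDist_pt _))).tendsto x

/-- The radius `t * infDist x Ωᶜ` is 1-Lipschitz in `x` since `t < 1`, so centre and radius each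
move by at most `‖z - x‖`. This accounts for the factor 2 in `dilatedSlope` and for `K / 2` below.
-/
theorem HasWeakGradient.eventually_abs_dilatedAverage_sub_le (h : HasWeakGradient Ω f g)
    (hΩ : IsOpen Ω) (hfm : Measurable f) (hf : ∫⁻ y, ‖f y‖ₑ ≠ ⊤) (hg : Measurable g)
    (hgi : ∫⁻ y, ‖g y‖ₑ ≠ ⊤) {R : ℝ} (hR : ∀ x r, Metric.ball x r ⊆ Ω → r ≤ R) {w' : ℝ → ℝ}
    (hw : ∀ r, 0 < r → HasDerivAt w (w' r) r) {C a : ℝ}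
    (hb : ∀ r, 0 < r → r ≤ R → |w' r| ≤ C * r ^ a ∧ |w r| ≤ C * r ^ a) {t : ℝ} (ht0 : 0 < t)
    (ht1 : t < 1) {x : EuclideanSpace ℝ (Fin n)} (hx : x ∈ Ω) {K : ℝ}
    (hK : dilatedSlope C a Ω f g t x < K) :
    ∀ᶠ z in nhds x, |dilatedAverage w Ω f t z - dilatedAverage w Ω f t x| ≤ K * ‖z - x‖ := by
  have hd := infDist_compl_pos hΩ (nonempty_compl_of_radius_bound hR) hx
  set r := t * Metric.infDist x Ωᶜ with hr
  have hr0 : 0 < r := by positivity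
  have hrd : r < Metric.infDist x Ωᶜ := mul_lt_of_lt_one_left hd ht1
  have hsub := ball_infDist_compl_subset Ω x
  obtain ⟨hw1, hw2⟩ := hb r hr0 (hR x r ((Metric.ball_subset_ball hrd.le).trans hsub))
  have hK2 : |w' r| * (ballLIntegral volume (fun y => ‖f y‖ₑ) x r).toReal +
      |w r| * (ballLIntegral volume (fun y => ‖g y‖ₑ) x r).toReal < K / 2 := by
    rw [dilatedSlope, ← hr] at hK
    have h1 := mul_le_mul_of_nonneg_right hw1
      (ENNReal.toReal_nonneg (a := ballLIntegral volume (fun y => ‖f y‖ₑ) x r))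
    have h2 := mul_le_mul_of_nonneg_right hw2
      (ENNReal.toReal_nonneg (a := ballLIntegral volume (fun y => ‖g y‖ₑ) x r))
    linarith
  have hK0 : 0 ≤ K / 2 := le_trans (by positivity) hK2.le
  filter_upwards [(tendsto_prodMk_mul_infDist Ω t x).eventually
    (h.eventually_abs_mul_ballLIntegral_sub_le hfm hf hg hgi hr0 hrd hsub (hw r hr0) hK2)] with z hz
  refine hz.trans ?_
  have h1 : |t * Metric.infDist z Ωᶜ - r| ≤ ‖z - x‖ := by
    rw [hr, ← mul_sub, abs_mul, abs_of_pos ht0, ← dist_eq_norm]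
    have h2 : |Metric.infDist z Ωᶜ - Metric.infDist x Ωᶜ| ≤ dist z x := by
      rw [← Real.dist_eq]
      simpa using (Metric.lipschitz_infDist_pt Ωᶜ).dist_le_mul z x
    exact (mul_le_of_le_one_left (abs_nonneg _) ht1.le).trans h2
  calc _ ≤ K / 2 * (‖z - x‖ + ‖z - x‖) := by gcongr
    _ = _ := by ring

theorem continuousOn_dilatedSlope (hΩ : IsOpen Ω) (hne : Ωᶜ.Nonempty) (hfm : Measurable f)
    (hf : ∫⁻ y, ‖f y‖ₑ ≠ ⊤) (hg : Measurable g) (hgi : ∫⁻ y, ‖g y‖ₑ ≠ ⊤) (C a : ℝ) {t : ℝ}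
    (ht0 : 0 < t) : ContinuousOn (dilatedSlope C a Ω f g t) Ω := by
  intro x hx
  apply ContinuousAt.continuousWithinAt
  have hr0 : 0 < t * Metric.infDist x Ωᶜ := mul_pos ht0 (infDist_compl_pos hΩ hne hx)
  have key : ∀ u : EuclideanSpace ℝ (Fin n) → ℝ≥0∞, AEMeasurable u volume → ∫⁻ y, u y ≠ ⊤ →
      ContinuousAt (fun z => (ballLIntegral volume u z (t * Metric.infDist z Ωᶜ)).toReal) x := by
    intro u hu hui
    have h1 := (continuousAt_ballLIntegral volume hu hui x hr0).tendsto.comp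
      (tendsto_prodMk_mul_infDist Ω t x)
    exact (ENNReal.tendsto_toReal (ballLIntegral_lt_top volume hui x hr0).ne).comp h1
  have hpow : ContinuousAt (fun z => (t * Metric.infDist z Ωᶜ) ^ a) x :=
    ContinuousAt.rpow_const
      (continuous_const.mul (Metric.continuous_infDist_pt _)).continuousAt (Or.inl hr0.ne')
  exact continuousAt_const.mul ((continuousAt_const.mul hpow).mul
    ((key _ hfm.enorm.aemeasurable hf).add (key _ hg.enorm.aemeasurable hgi)))

theorem ofReal_rpow_mul_ballLIntegral_le {R a : ℝ} (u : EuclideanSpace ℝ (Fin n) → ℝ≥0∞)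
    {r : ℝ} (hr0 : 0 < r) (hrR : r ≤ R) (x : EuclideanSpace ℝ (Fin n)) :
    ENNReal.ofReal (r ^ a) * ballLIntegral volume u x r ≤ fracMaximal volume a R u x := by
  rw [ballLIntegral_eq volume u x hr0, ← mul_assoc, ← ENNReal.ofReal_mul (by positivity),
    ← Real.rpow_add hr0, ← sub_eq_add_neg]
  exact le_fracMaximal hr0 hrR u x

/-- The decisive point is that the right side is independent of `t`. -/
theorem ofReal_dilatedSlope_le (hΩ : IsOpen Ω) (hfm : Measurable f)
    (hf : ∫⁻ y, ‖f y‖ₑ ≠ ⊤) (hgi : ∫⁻ y, ‖g y‖ₑ ≠ ⊤) {R : ℝ}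
    (hR : ∀ x r, Metric.ball x r ⊆ Ω → r ≤ R) {C a : ℝ} (hC : 0 ≤ C) {t : ℝ}
    (ht0 : 0 < t) (ht1 : t < 1) {x : EuclideanSpace ℝ (Fin n)} (hx : x ∈ Ω) :
    ENNReal.ofReal (dilatedSlope C a Ω f g t x) ≤
      ENNReal.ofReal (2 * C) * fracMaximal volume a R (fun y => ‖f y‖ₑ + ‖g y‖ₑ) x := by
  have hd := infDist_compl_pos hΩ (nonempty_compl_of_radius_bound hR) hx
  rw [dilatedSlope]
  set r := t * Metric.infDist x Ωᶜ with hr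
  have hr0 : 0 < r := by positivity
  have hrd : r < Metric.infDist x Ωᶜ := mul_lt_of_lt_one_left hd ht1
  have hrR := hR x r ((Metric.ball_subset_ball hrd.le).trans (ball_infDist_compl_subset Ω x))
  rw [show ∀ A B : ℝ, 2 * (C * r ^ a * (A + B)) = 2 * C * (r ^ a * (A + B)) by intros; ring,
    ENNReal.ofReal_mul (p := 2 * C) (by positivity), ENNReal.ofReal_mul (p := r ^ a) (by positivity),
    ENNReal.ofReal_add ENNReal.toReal_nonneg ENNReal.toReal_nonneg,
    ENNReal.ofReal_toReal (ballLIntegral_lt_top volume hf x hr0).ne,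
    ENNReal.ofReal_toReal (ballLIntegral_lt_top volume hgi x hr0).ne]
  gcongr
  refine le_trans (le_of_eq ?_) (ofReal_rpow_mul_ballLIntegral_le _ hr0 hrR x)
  congr 1
  exact (lintegral_add_left (hfm.comp (by fun_prop)).enorm _).symm

end DilatedAverage

/-! ### The local maximal function as a countable supremum. -/

section LocalMaximal

variable {n : ℕ} {Ω : Set (EuclideanSpace ℝ (Fin n))} {f : EuclideanSpace ℝ (Fin n) → ℝ}

theorem ball_subset_of_ofReal_lt_infEDist_compl {X : Type*} [PseudoMetricSpace X] {Ω : Set X}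
    {x : X} {r : ℝ} (h : ENNReal.ofReal r < Metric.infEDist x Ωᶜ) : Metric.ball x r ⊆ Ω := by
  intro y hy
  by_contra hyΩ
  have h1 : Metric.infEDist x Ωᶜ ≤ edist x y := Metric.infEDist_le_edist_of_mem hyΩ
  have h2 : edist x y ≤ ENNReal.ofReal r := by
    rw [edist_dist, dist_comm]
    exact ENNReal.ofReal_le_ofReal (Metric.mem_ball.1 hy).le
  exact absurd (h1.trans h2) (not_le.2 h)

/-- All competing balls lie in `Ω`. This permits replacing `f` by a measurable representative that
vanishes outside `Ω`. -/
theorem localFracMaximal_congr_ae (γ β : ℝ) {f₁ f₂ : EuclideanSpace ℝ (Fin n) → ℝ}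
    (h : f₁ =ᵐ[volume.restrict Ω] f₂) :
    localFracMaximal γ β Ω f₁ = localFracMaximal γ β Ω f₂ := by
  funext x
  unfold localFracMaximal
  refine iSup_congr fun r => iSup_congr fun _ => iSup_congr fun hr => ?_
  congr 1
  refine lintegral_congr_ae ?_
  filter_upwards [ae_restrict_of_ae_restrict_of_subset
    (ball_subset_of_ofReal_lt_infEDist_compl hr) h] with y hy
  rw [hy]

theorem localFracMaximal_term_eq (γ β : ℝ) (u : EuclideanSpace ℝ (Fin n) → ℝ≥0∞)
    (x : EuclideanSpace ℝ (Fin n)) {r : ℝ} (hr : 0 < r) :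
    ENNReal.ofReal (r ^ β * (1 + r ^ n) ^ (γ * β / n) /
      (growthFun γ (volume.real (Metric.ball x r)) * volume.real (Metric.ball x r))) *
      ∫⁻ y in Metric.ball x r, u y =
    ENNReal.ofReal (maximalWeight n γ β
      (volume.real (Metric.ball (0 : EuclideanSpace ℝ (Fin n)) 1)) r) *
        ballLIntegral volume u x r := by
  set c := volume.real (Metric.ball (0 : EuclideanSpace ℝ (Fin n)) 1) with hc
  have hc0 : 0 < c := ENNReal.toReal_pos (Metric.measure_ball_pos volume _ one_pos).ne'
    measure_ball_lt_top.ne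
  have hvol : volume.real (Metric.ball x r) = c * r ^ n := by
    rw [Measure.real, Measure.addHaar_ball_of_pos volume x hr, ENNReal.toReal_mul,
      ENNReal.toReal_ofReal (by positivity), finrank_euclideanSpace_fin, mul_comm]
    rfl
  rw [ballLIntegral_eq volume u x hr, ← mul_assoc,
    ← ENNReal.ofReal_mul (maximalWeight_nonneg n γ β hc0 hr.le)]
  congr 2
  have hp : (0 : ℝ) < (1 + c * r ^ n) ^ γ := Real.rpow_pos_of_pos (by positivity) _
  rw [hvol, growthFun, maximalWeight, Real.rpow_neg hr.le, finrank_euclideanSpace_fin,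
    Real.rpow_natCast]
  field_simp

/-- Admissible radii are exactly `t * d` with `0 < t < 1` and `d` the distance to the complement.
Each term is continuous in `t`, so rational `t` suffice; countability yields measurability. -/
theorem localFracMaximal_eq_iSup (γ β : ℝ) (hΩ : IsOpen Ω) (hne : Ωᶜ.Nonempty)
    (hfm : Measurable f) (hf : ∫⁻ y, ‖f y‖ₑ ≠ ⊤)
    (hw : ∀ r, 0 < r → ContinuousAt (maximalWeight n γ β
      (volume.real (Metric.ball (0 : EuclideanSpace ℝ (Fin n)) 1))) r)
    {x : EuclideanSpace ℝ (Fin n)} (hx : x ∈ Ω) :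
    localFracMaximal γ β Ω f x = ⨆ t : {t : ℚ // (0 : ℝ) < t ∧ (t : ℝ) < 1},
      ENNReal.ofReal (dilatedAverage (maximalWeight n γ β
        (volume.real (Metric.ball (0 : EuclideanSpace ℝ (Fin n)) 1))) Ω f t x) := by
  set c := volume.real (Metric.ball (0 : EuclideanSpace ℝ (Fin n)) 1) with hc
  have hc0 : 0 < c := ENNReal.toReal_pos (Metric.measure_ball_pos volume _ one_pos).ne'
    measure_ball_lt_top.ne
  have hd := infDist_compl_pos hΩ hne hx
  set d := Metric.infDist x Ωᶜ with hd'
  have hterm : ∀ t : ℝ, 0 < t → ENNReal.ofReal (dilatedAverage (maximalWeight n γ β c) Ω f t x) =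
      ENNReal.ofReal (maximalWeight n γ β c (t * d)) *
        ballLIntegral volume (fun y => ‖f y‖ₑ) x (t * d) := by
    intro t ht
    have h0 : 0 < t * d := by positivity
    rw [dilatedAverage, ENNReal.ofReal_mul (maximalWeight_nonneg n γ β hc0 h0.le),
      ENNReal.ofReal_toReal (ballLIntegral_lt_top volume hf x h0).ne]
  have hlt : ∀ r, 0 < r → (ENNReal.ofReal r < Metric.infEDist x Ωᶜ ↔ r < d) := fun r hr =>
    ENNReal.ofReal_lt_iff_lt_toReal hr.le (Metric.infEDist_ne_top hne)
  apply le_antisymm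
  · refine iSup_le fun r => iSup_le fun hr => iSup_le fun hrd => ?_
    rw [hlt r hr] at hrd
    rw [localFracMaximal_term_eq γ β _ x hr]
    set S := ⨆ t : {t : ℚ // (0 : ℝ) < t ∧ (t : ℝ) < 1},
      ENNReal.ofReal (dilatedAverage (maximalWeight n γ β c) Ω f t x) with hS
    by_contra! hcon
    have hcont : ContinuousAt (fun t : ℝ => ENNReal.ofReal (dilatedAverage
        (maximalWeight n γ β c) Ω f t x)) (r / d) := by
      have htd : r / d * d = r := div_mul_cancel₀ r hd.ne'
      have hmul : ContinuousAt (fun t : ℝ => t * d) (r / d) := by fun_prop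
      have h1 : ContinuousAt (fun t : ℝ => maximalWeight n γ β c (t * d)) (r / d) :=
        ContinuousAt.comp (f := fun t : ℝ => t * d) (g := maximalWeight n γ β c)
          (by rw [htd]; exact hw r hr) hmul
      have h2 : ContinuousAt (fun z : ℝ => (ballLIntegral volume (fun y => ‖f y‖ₑ) x
          (z * d)).toReal) (r / d) := by
        have h3 := continuousAt_ballLIntegral volume hfm.enorm.aemeasurable hf x hr
        have h4 : ContinuousAt (fun z : ℝ => (x, z * d)) (r / d) := by fun_prop
        have h5 : ContinuousAt (fun z : ℝ => ballLIntegral volume (fun y => ‖f y‖ₑ) x (z * d))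
            (r / d) := ContinuousAt.comp (f := fun z : ℝ => (x, z * d))
              (g := fun z : EuclideanSpace ℝ (Fin n) × ℝ =>
                ballLIntegral volume (fun y => ‖f y‖ₑ) z.1 z.2) (by rw [htd]; exact h3) h4
        refine (ENNReal.tendsto_toReal ?_).comp h5
        rw [htd]
        exact (ballLIntegral_lt_top volume hf x hr).ne
      exact ENNReal.continuous_ofReal.continuousAt.comp (h1.mul h2)
    have h0 : 0 < r / d := by positivity
    have h1 : r / d < 1 := (div_lt_one hd).2 hrd
    have hev : ∀ᶠ t : ℝ in nhds (r / d), S < ENNReal.ofReal (dilatedAverage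
        (maximalWeight n γ β c) Ω f t x) ∧ 0 < t ∧ t < 1 := by
      refine (hcont.eventually (lt_mem_nhds ?_)).and ((lt_mem_nhds h0).and (gt_mem_nhds h1))
      dsimp only
      rw [hterm _ h0, div_mul_cancel₀ r hd.ne']
      exact hcon
    obtain ⟨V, hV, hVo, hrV⟩ := eventually_nhds_iff.1 hev
    obtain ⟨q, hq⟩ := Rat.denseRange_cast.exists_mem_open hVo ⟨_, hrV⟩
    obtain ⟨hq1, hq2, hq3⟩ := hV _ hq
    exact absurd (le_iSup (fun t : {t : ℚ // (0 : ℝ) < t ∧ (t : ℝ) < 1} =>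
      ENNReal.ofReal (dilatedAverage (maximalWeight n γ β c) Ω f t x)) ⟨q, hq2, hq3⟩)
      (not_le.2 hq1)
  · refine iSup_le fun t => ?_
    have h0 : 0 < (t : ℝ) * d := mul_pos t.2.1 hd
    rw [hterm _ t.2.1, ← localFracMaximal_term_eq γ β _ x h0]
    exact le_iSup_of_le ((t : ℝ) * d) (le_iSup_of_le h0 (le_iSup_of_le
      ((hlt _ h0).2 (mul_lt_of_lt_one_left hd t.2.2)) le_rfl))

/-- Stated with a majorant `u` of `‖f‖ₑ` so that one maximal function, that of `‖f‖ₑ + ‖g‖ₑ`, bounds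
both the function and its gradient. -/
theorem localFracMaximal_le_fracMaximal (γ β : ℝ) {R : ℝ}
    (hR : ∀ x r, Metric.ball x r ⊆ Ω → r ≤ R) {C a : ℝ} (hC : 0 ≤ C)
    (hb : ∀ r, 0 < r → r ≤ R → |maximalWeight n γ β
      (volume.real (Metric.ball (0 : EuclideanSpace ℝ (Fin n)) 1)) r| ≤ C * r ^ a)
    {u : EuclideanSpace ℝ (Fin n) → ℝ≥0∞} (hu : ∀ y, ‖f y‖ₑ ≤ u y)
    (x : EuclideanSpace ℝ (Fin n)) :
    localFracMaximal γ β Ω f x ≤ ENNReal.ofReal C * fracMaximal volume a R u x := by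
  refine iSup_le fun r => iSup_le fun hr => iSup_le fun hrd => ?_
  have hrR := hR x r (ball_subset_of_ofReal_lt_infEDist_compl hrd)
  rw [localFracMaximal_term_eq γ β _ x hr]
  calc _ ≤ ENNReal.ofReal (C * r ^ a) * ballLIntegral volume u x r := by
        gcongr
        · exact (le_abs_self _).trans (hb r hr hrR)
        · exact lintegral_mono fun y => hu _
    _ ≤ _ := by
        rw [ENNReal.ofReal_mul hC, mul_assoc]
        gcongr
        exact ofReal_rpow_mul_ballLIntegral_le u hr hrR x

end LocalMaximal

/-! ### Weak differentiability of the local maximal function. -/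

section Regularity

variable {n : ℕ} {Ω : Set (EuclideanSpace ℝ (Fin n))} {f : EuclideanSpace ℝ (Fin n) → ℝ}
  {g : EuclideanSpace ℝ (Fin n) → EuclideanSpace ℝ (Fin n)}

theorem enorm_euclideanSpace_le_of_forall_enorm_apply_le {v : EuclideanSpace ℝ (Fin n)} {b : ℝ≥0∞}
    (h : ∀ i, ‖v i‖ₑ ≤ b) : ‖v‖ₑ ≤ n * b := by
  have hv : v = ∑ i, v i • EuclideanSpace.single i (1 : ℝ) := by
    ext j
    simp [Finset.sum_apply, Pi.single_apply]
  calc ‖v‖ₑ = ‖∑ i, v i • EuclideanSpace.single i (1 : ℝ)‖ₑ := by rw [← hv]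
    _ ≤ ∑ i, ‖v i • EuclideanSpace.single i (1 : ℝ)‖ₑ := enorm_sum_le _ _
    _ ≤ ∑ _i : Fin n, b := by
        refine Finset.sum_le_sum fun i _ => ?_
        have : ‖EuclideanSpace.single i (1 : ℝ)‖ₑ = 1 := by
          rw [← ofReal_norm]; simp
        rw [enorm_smul, this, mul_one]
        exact h i
    _ = n * b := by simp

/-- A function whose increments along coordinate segments in `Ω` are controlled by the line
integrals of an integrable `G` has a weak gradient dominated by `G`. -/
theorem exists_hasWeakGradient_of_segment_le (hΩ : IsOpen Ω)
    {F G : EuclideanSpace ℝ (Fin n) → ℝ≥0∞} (hF : AEMeasurable F (volume.restrict Ω))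
    (hFi : ∫⁻ x in Ω, F x ≠ ⊤) (hG : Measurable G) (hGi : ∫⁻ x in Ω, G x ≠ ⊤)
    (hFG : ∀ (x e : EuclideanSpace ℝ (Fin n)) (h : ℝ), ‖e‖ ≤ 1 → 0 ≤ h →
      (∀ s ∈ Set.Icc 0 h, x - s • e ∈ Ω) →
      F x ≤ F (x - h • e) + ∫⁻ s in Set.Ioc 0 h, G (x - s • e) ∧
      F (x - h • e) ≤ F x + ∫⁻ s in Set.Ioc 0 h, G (x - s • e)) :
    ∃ v : EuclideanSpace ℝ (Fin n) → EuclideanSpace ℝ (Fin n), Measurable v ∧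
      HasWeakGradient Ω (fun x => (F x).toReal) v ∧
      ∀ᵐ x ∂volume.restrict Ω, ‖v x‖ₑ ≤ n * G x := by
  have hFint : IntegrableOn (fun x => (F x).toReal) Ω volume :=
    integrable_toReal_of_lintegral_ne_top hF hFi
  have hex := fun i : Fin n => exists_weak_derivative_of_abs_le volume hFint
    (EuclideanSpace.single i (1 : ℝ)) hG hGi fun ψ hψ =>
      enorm_integral_mul_fderiv_le volume hΩ hF hFi hG hGi
        (fun x h hh hseg => hFG x _ h (by simp) hh hseg) hψ
  choose v hvm hvb hv using hex
  have hvm' : Measurable fun x => WithLp.toLp 2 fun i => v i x :=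
    (PiLp.continuous_toLp 2 _).measurable.comp (measurable_pi_lambda _ hvm)
  have hb : ∀ᵐ x ∂volume.restrict Ω, ‖WithLp.toLp 2 fun i => v i x‖ₑ ≤ n * G x := by
    filter_upwards [ae_all_iff.2 hvb] with x hx
    exact enorm_euclideanSpace_le_of_forall_enorm_apply_le hx
  refine ⟨_, hvm', ⟨hFint.locallyIntegrableOn, ?_, fun ψ h1 h2 h3 i => hv i ψ ⟨h1, h2, h3⟩⟩, hb⟩
  refine IntegrableOn.locallyIntegrableOn ⟨hvm'.aestronglyMeasurable, ?_⟩
  refine (lintegral_mono_ae hb).trans_lt ?_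
  rw [lintegral_const_mul _ hG]
  exact ENNReal.mul_lt_top (by finiteness) hGi.lt_top

/-- All dilated averages obey the same line-integral bound, so their supremum does too, and the
segment criterion applies. -/
theorem HasWeakGradient.exists_hasWeakGradient_localFracMaximal (h : HasWeakGradient Ω f g)
    (hΩ : IsOpen Ω) (hfm : Measurable f) (hf : ∫⁻ y, ‖f y‖ₑ ≠ ⊤) (hg : Measurable g)
    (hgi : ∫⁻ y, ‖g y‖ₑ ≠ ⊤) (γ β : ℝ) {R : ℝ} (hR : ∀ x r, Metric.ball x r ⊆ Ω → r ≤ R)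
    {w' : ℝ → ℝ} (hw : ∀ r, 0 < r → HasDerivAt (maximalWeight n γ β
      (volume.real (Metric.ball (0 : EuclideanSpace ℝ (Fin n)) 1))) (w' r) r) {C a : ℝ}
    (hC : 0 ≤ C) (hb : ∀ r, 0 < r → r ≤ R → |w' r| ≤ C * r ^ a ∧ |maximalWeight n γ β
      (volume.real (Metric.ball (0 : EuclideanSpace ℝ (Fin n)) 1)) r| ≤ C * r ^ a)
    (hint : ∫⁻ x in Ω, fracMaximal volume a R (fun y => ‖f y‖ₑ + ‖g y‖ₑ) x ≠ ⊤) :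
    AEMeasurable (localFracMaximal γ β Ω f) (volume.restrict Ω) ∧
    ∃ v : EuclideanSpace ℝ (Fin n) → EuclideanSpace ℝ (Fin n), Measurable v ∧
      HasWeakGradient Ω (fun x => (localFracMaximal γ β Ω f x).toReal) v ∧
      ∀ᵐ x ∂volume.restrict Ω, ‖v x‖ₑ ≤
        n * (ENNReal.ofReal (2 * C) * fracMaximal volume a R (fun y => ‖f y‖ₑ + ‖g y‖ₑ) x) := by
  have hne := nonempty_compl_of_radius_bound hR
  set w := maximalWeight n γ β (volume.real (Metric.ball (0 : EuclideanSpace ℝ (Fin n)) 1)) with hwdef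
  set M := fracMaximal volume a R (fun y => ‖f y‖ₑ + ‖g y‖ₑ) with hM
  have hMm : Measurable M := measurable_fracMaximal volume a R _
  have hsup : ∀ x ∈ Ω, localFracMaximal γ β Ω f x =
      ⨆ t : {t : ℚ // (0 : ℝ) < t ∧ (t : ℝ) < 1},
        ENNReal.ofReal (dilatedAverage w Ω f t x) := fun x hx =>
    localFracMaximal_eq_iSup γ β hΩ hne hfm hf (fun r hr => (hw r hr).continuousAt) hx
  have hslope : ∀ t : {t : ℚ // (0 : ℝ) < t ∧ (t : ℝ) < 1}, ∀ x ∈ Ω, ∀ K,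
      dilatedSlope C a Ω f g t x < K → ∀ᶠ z in nhds x,
        |dilatedAverage w Ω f t z - dilatedAverage w Ω f t x| ≤ K * ‖z - x‖ := fun t x hx K hK =>
    h.eventually_abs_dilatedAverage_sub_le hΩ hfm hf hg hgi hR hw hb t.2.1 t.2.2 hx hK
  have hcont : ∀ t : {t : ℚ // (0 : ℝ) < t ∧ (t : ℝ) < 1},
      ContinuousOn (dilatedAverage w Ω f t) Ω := by
    intro t x hx
    apply ContinuousAt.continuousWithinAt
    rw [ContinuousAt, tendsto_iff_dist_tendsto_zero]
    refine squeeze_zero' (.of_forall fun _ => dist_nonneg) (hslope t x hx _ (lt_add_one _)) ?_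
    have : Continuous fun z => (dilatedSlope C a Ω f g t x + 1) * ‖z - x‖ := by fun_prop
    simpa using this.tendsto x
  have hmeas : AEMeasurable (localFracMaximal γ β Ω f) (volume.restrict Ω) := by
    have h1 : AEMeasurable (fun x => ⨆ t : {t : ℚ // (0 : ℝ) < t ∧ (t : ℝ) < 1},
        ENNReal.ofReal (dilatedAverage w Ω f t x)) (volume.restrict Ω) :=
      AEMeasurable.iSup fun t => ((hcont t).aemeasurable hΩ.measurableSet).ennreal_ofReal
    refine h1.congr ((ae_restrict_iff' hΩ.measurableSet).2 (.of_forall fun x hx => ?_))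
    exact (hsup x hx).symm
  refine ⟨hmeas, exists_hasWeakGradient_of_segment_le hΩ hmeas ?_ (hMm.const_mul _) ?_ ?_⟩
  · refine ne_top_of_le_ne_top (ENNReal.mul_ne_top (ENNReal.ofReal_ne_top (r := C)) hint) ?_
    rw [← lintegral_const_mul _ hMm]
    exact lintegral_mono fun x => localFracMaximal_le_fracMaximal γ β hR hC
      (fun r h0 h1 => (hb r h0 h1).2) (fun y => le_self_add) x
  · rw [lintegral_const_mul _ hMm]
    exact ENNReal.mul_ne_top ENNReal.ofReal_ne_top hint
  · intro x e s he hs hseg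
    have hx : x ∈ Ω := by simpa using hseg 0 ⟨le_rfl, hs⟩
    have hxs := hseg s ⟨hs, le_rfl⟩
    rw [hsup x hx, hsup _ hxs]
    -- The estimate for one `t`, with its own slope; `hle` then replaces that slope by the common
    -- majorant, after which the supremum may be taken on both sides.
    have key : ∀ t : {t : ℚ // (0 : ℝ) < t ∧ (t : ℝ) < 1}, _ := fun t =>
      enorm_le_add_lintegral_segment hΩ
        (continuousOn_dilatedSlope hΩ hne hfm hf hg hgi C a t.2.1)
        (fun z hz => by
          have := infDist_compl_pos hΩ hne hz
          have := t.2.1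
          unfold dilatedSlope
          positivity) (hslope t) he hs hseg
    have hle : ∀ t : {t : ℚ // (0 : ℝ) < t ∧ (t : ℝ) < 1},
        ∫⁻ z in Set.Ioc 0 s, ENNReal.ofReal (dilatedSlope C a Ω f g t (x - z • e)) ≤
          ∫⁻ z in Set.Ioc 0 s, ENNReal.ofReal (2 * C) * M (x - z • e) := fun t =>
      setLIntegral_mono_ae' measurableSet_Ioc (.of_forall fun z hz =>
        ofReal_dilatedSlope_le hΩ hfm hf hgi hR hC t.2.1 t.2.2 (hseg z ⟨hz.1.le, hz.2⟩))
    constructor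
    · refine iSup_le fun t => (key t).1.trans (add_le_add ?_ (hle t))
      exact le_iSup (fun t : {t : ℚ // (0 : ℝ) < t ∧ (t : ℝ) < 1} =>
        ENNReal.ofReal (dilatedAverage w Ω f t (x - s • e))) t
    · refine iSup_le fun t => (key t).2.trans (add_le_add ?_ (hle t))
      exact le_iSup (fun t : {t : ℚ // (0 : ℝ) < t ∧ (t : ℝ) < 1} =>
        ENNReal.ofReal (dilatedAverage w Ω f t x)) t

end Regularity

/-! ### Sobolev functions, representatives and `L^q` norms. -/

section Sobolev

variable {n : ℕ} {Ω : Set (EuclideanSpace ℝ (Fin n))} {f : EuclideanSpace ℝ (Fin n) → ℝ}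

theorem MemSobolev.hasWeakGradient_weakGradient (hΩ : IsOpen Ω) {p : ℝ≥0∞} (h : MemSobolev Ω p f) :
    HasWeakGradient Ω f (weakGradient Ω f) ∧ MemLp (weakGradient Ω f) p (volume.restrict Ω) := by
  obtain ⟨-, g, hg, hgp⟩ := h
  have hex : ∃ g, HasWeakGradient Ω f g := ⟨g, hg⟩
  have h1 : HasWeakGradient Ω f (weakGradient Ω f) := by
    rw [weakGradient, dif_pos hex]
    exact hex.choose_spec
  exact ⟨h1, (memLp_congr_ae (hg.ae_eq hΩ h1)).1 hgp⟩

theorem HasWeakGradient.congr_ae {f₁ f₂ : EuclideanSpace ℝ (Fin n) → ℝ}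
    {g₁ g₂ : EuclideanSpace ℝ (Fin n) → EuclideanSpace ℝ (Fin n)} (h : HasWeakGradient Ω f₁ g₁)
    (hf : f₁ =ᵐ[volume.restrict Ω] f₂) (hg : g₁ =ᵐ[volume.restrict Ω] g₂)
    (hf₂ : LocallyIntegrableOn f₂ Ω volume) (hg₂ : LocallyIntegrableOn g₂ Ω volume) :
    HasWeakGradient Ω f₂ g₂ := by
  refine ⟨hf₂, hg₂, fun ψ h1 h2 h3 i => ?_⟩
  have e1 : ∫ x in Ω, f₂ x * fderiv ℝ ψ x (EuclideanSpace.single i 1) =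
      ∫ x in Ω, f₁ x * fderiv ℝ ψ x (EuclideanSpace.single i 1) :=
    integral_congr_ae (hf.mono fun x hx => by dsimp only; rw [hx])
  have e2 : ∫ x in Ω, g₂ x i * ψ x = ∫ x in Ω, g₁ x i * ψ x :=
    integral_congr_ae (hg.mono fun x hx => by dsimp only; rw [hx])
  rw [e1, e2]
  exact h.integral_eq ψ h1 h2 h3 i

/-- Supplies globally measurable, globally integrable representatives of `f` and `∇f`, as the
maximal and mollification estimates require. -/
theorem MeasureTheory.MemLp.exists_measurable_eq_zero_outside {F : Type*} [NormedAddCommGroup F]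
    [MeasurableSpace F] [BorelSpace F] {X : Type*} [MeasurableSpace X] {μ : Measure X} {s : Set X}
    {p : ℝ≥0∞} {u : X → F} (hs : MeasurableSet s) (hu : MemLp u p (μ.restrict s)) :
    ∃ v : X → F, Measurable v ∧ u =ᵐ[μ.restrict s] v ∧ (∀ x ∉ s, v x = 0) ∧
      eLpNorm v p μ = eLpNorm u p (μ.restrict s) := by
  have hmk := hu.1.ae_eq_mk
  have hind : u =ᵐ[μ.restrict s] s.indicator (hu.1.mk u) := by
    filter_upwards [hmk, ae_restrict_mem hs] with x hx hxs
    rw [Set.indicator_of_mem hxs, hx]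
  refine ⟨s.indicator (hu.1.mk u), hu.1.stronglyMeasurable_mk.measurable.indicator hs, hind,
    fun x hx => Set.indicator_of_notMem hx _, ?_⟩
  rw [eLpNorm_indicator_eq_eLpNorm_restrict hs]
  exact (eLpNorm_congr_ae hmk).symm

theorem eLpNorm_ofReal_eq_lintegral_rpow {X F : Type*} [MeasurableSpace X] {μ : Measure X}
    [NormedAddCommGroup F] {p : ℝ} (hp : 0 < p) (u : X → F) :
    eLpNorm u (ENNReal.ofReal p) μ = (∫⁻ x, ‖u x‖ₑ ^ p ∂μ) ^ (1 / p) := by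
  rw [eLpNorm_eq_lintegral_rpow_enorm_toReal (by simpa using hp) ENNReal.ofReal_ne_top,
    ENNReal.toReal_ofReal hp.le]

theorem eLpNorm_le_const_mul_lintegral_rpow {X F : Type*} [MeasurableSpace X] {μ : Measure X}
    [NormedAddCommGroup F] {q : ℝ} (hq : 0 < q) {u : X → F} {b : ℝ≥0∞} (hb : b ≠ ⊤)
    {M : X → ℝ≥0∞} (h : ∀ᵐ x ∂μ, ‖u x‖ₑ ≤ b * M x) :
    eLpNorm u (ENNReal.ofReal q) μ ≤ b * (∫⁻ x, M x ^ q ∂μ) ^ (1 / q) := by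
  rw [eLpNorm_ofReal_eq_lintegral_rpow hq]
  calc _ ≤ (∫⁻ x, b ^ q * M x ^ q ∂μ) ^ (1 / q) := by
        refine ENNReal.rpow_le_rpow (lintegral_mono_ae (h.mono fun x hx => ?_)) (by positivity)
        rw [← ENNReal.mul_rpow_of_nonneg _ _ hq.le]
        exact ENNReal.rpow_le_rpow hx hq.le
    _ = _ := by
        rw [lintegral_const_mul' _ _ (ENNReal.rpow_ne_top_of_nonneg hq.le hb),
          ENNReal.mul_rpow_of_nonneg _ _ (by positivity), ← ENNReal.rpow_mul,
          mul_one_div_cancel hq.ne', ENNReal.rpow_one]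

theorem lintegral_ne_top_of_lintegral_rpow_ne_top {X : Type*} [MeasurableSpace X] {μ : Measure X}
    [IsFiniteMeasure μ] {q : ℝ} (hq : 1 ≤ q) {M : X → ℝ≥0∞} (h : ∫⁻ x, M x ^ q ∂μ ≠ ⊤) :
    ∫⁻ x, M x ∂μ ≠ ⊤ := by
  have hpt : ∀ x, M x ≤ 1 + M x ^ q := fun x => by
    rcases le_total (M x) 1 with h1 | h1
    · exact h1.trans le_self_add
    · exact (ENNReal.le_rpow_self_of_one_le h1 hq).trans le_add_self
  refine ne_top_of_le_ne_top ?_ (lintegral_mono hpt)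
  rw [lintegral_add_left measurable_const, lintegral_one]
  exact ENNReal.add_ne_top.2 ⟨measure_ne_top _ _, h⟩

end Sobolev

/-! ### The Sobolev bound. -/

theorem theorem1p4 (n : ℕ) (p q β γ : ℝ) (hp : 1 < p) (hpn : p < n) (hβ : 1 ≤ β)
    (hβ' : β < n / p) (hγ : 0 ≤ γ) (hγ' : γ ≤ n) (hq : 1 / q = 1 / p - (β - 1) / n)
    (Ω : Set (EuclideanSpace ℝ (Fin n))) (hΩ : IsOpen Ω) (hfin : volume Ω < ⊤) :
    ∃ C : ℝ≥0, 0 < C ∧ ∀ f : EuclideanSpace ℝ (Fin n) → ℝ,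
      MemSobolev Ω (ENNReal.ofReal p) f →
        (∀ᵐ x ∂volume.restrict Ω, localFracMaximal γ β Ω f x < ⊤) ∧
        MemSobolev Ω (ENNReal.ofReal q) (fun x => (localFracMaximal γ β Ω f x).toReal) ∧
        sobolevNorm Ω (ENNReal.ofReal q) (fun x => (localFracMaximal γ β Ω f x).toReal) ≤
          C * sobolevNorm Ω (ENNReal.ofReal p) f := by
  have hp0 : 0 < p := by linarith
  have hn0 : (0 : ℝ) < n := by linarith
  have hn : n ≠ 0 := by rintro rfl; simp at hn0
  have hβp : β * p < n := (lt_div_iff₀ hp0).1 hβ'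
  have hap : (β - 1) * p < Module.finrank ℝ (EuclideanSpace ℝ (Fin n)) := by
    rw [finrank_euclideanSpace_fin]; nlinarith
  -- Positivity of `1 / q` means `(β - 1) p < n`, which follows from `β p < n`.
  have hqpos : 0 < 1 / q := by
    rw [hq, sub_pos, div_lt_div_iff₀ hn0 hp0]; nlinarith
  have hq0 : 0 < q := one_div_pos.1 hqpos
  have hq1 : 1 ≤ q := by
    have h1 : 1 / q ≤ 1 / p := by
      rw [hq]; exact sub_le_self _ (div_nonneg (by linarith) hn0.le)
    exact hp.le.trans ((one_div_le_one_div hq0 hp0).1 h1)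
  have : IsFiniteMeasure (volume.restrict Ω) := ⟨by simpa using hfin⟩
  obtain ⟨R, hR0, hR⟩ := exists_radius_bound hn hfin
  set c := volume.real (Metric.ball (0 : EuclideanSpace ℝ (Fin n)) 1) with hc
  have hc0 : 0 < c := ENNReal.toReal_pos (Metric.measure_ball_pos volume _ one_pos).ne'
    measure_ball_lt_top.ne
  obtain ⟨C, w', hC0, hw, hwb⟩ := exists_hasDerivAt_maximalWeight n γ hβ hc0 hR0
  obtain ⟨D, hD⟩ := exists_lintegral_fracMaximal_rpow_le
    (volume : Measure (EuclideanSpace ℝ (Fin n))) (q := q) (α := β - 1) hp (by linarith) hap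
    (by rw [finrank_euclideanSpace_fin]; exact hq)
  -- The first summand comes from the size of the maximal function, the second from its `n` partial
  -- derivatives, each with slope constant `2 * C`; `D ^ (1 / q)` is the norm bound of the
  -- fractional maximal operator.
  set A : ℝ≥0 := (C.toNNReal + n * (2 * C).toNNReal) * D ^ (1 / q) with hA
  -- Adding 1 serves only to make the constant positive.
  refine ⟨A + 1, by positivity, fun f hf => ?_⟩
  obtain ⟨hgrad, hgradp⟩ := hf.hasWeakGradient_weakGradient hΩ
  obtain ⟨f₁, hf₁m, hf₁, hf₁0, hf₁n⟩ := hf.1.exists_measurable_eq_zero_outside hΩ.measurableSet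
  obtain ⟨g₁, hg₁m, hg₁, hg₁0, hg₁n⟩ := hgradp.exists_measurable_eq_zero_outside hΩ.measurableSet
  have hp1 : (1 : ℝ≥0∞) ≤ ENNReal.ofReal p := ENNReal.one_le_ofReal.2 hp.le
  have hL1 : ∀ {F : Type} [NormedAddCommGroup F] (u v : EuclideanSpace ℝ (Fin n) → F),
      MemLp u (ENNReal.ofReal p) (volume.restrict Ω) → u =ᵐ[volume.restrict Ω] v →
      (∀ x ∉ Ω, v x = 0) → IntegrableOn v Ω volume ∧ ∫⁻ y, ‖v y‖ₑ ≠ ⊤ := by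
    intro F _ u v hu huv hv
    have h1 : IntegrableOn v Ω volume := (hu.integrable hp1).congr huv
    refine ⟨h1, ?_⟩
    have h2 := h1.2.ne
    rwa [setLIntegral_eq_of_support_subset] at h2
    intro x hx
    by_contra h0
    exact hx (by simp [hv x h0])
  obtain ⟨hf₁i, hf₁t⟩ := hL1 f f₁ hf.1 hf₁ hf₁0
  obtain ⟨hg₁i, hg₁t⟩ := hL1 _ g₁ hgradp hg₁ hg₁0
  have hwg : HasWeakGradient Ω f₁ g₁ :=
    hgrad.congr_ae hf₁ hg₁ hf₁i.locallyIntegrableOn hg₁i.locallyIntegrableOn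
  have hum : Measurable fun y => ‖f₁ y‖ₑ + ‖g₁ y‖ₑ := hf₁m.enorm.add hg₁m.enorm
  have hut : ∫⁻ y, (‖f₁ y‖ₑ + ‖g₁ y‖ₑ) ≠ ⊤ := by
    rw [lintegral_add_left hf₁m.enorm]; exact ENNReal.add_ne_top.2 ⟨hf₁t, hg₁t⟩
  set M := fracMaximal volume (β - 1) R (fun y => ‖f₁ y‖ₑ + ‖g₁ y‖ₑ) with hM
  -- Minkowski's inequality; the representatives vanish outside `Ω`, so their norms on the whole
  -- space are those on `Ω`.
  have hN : (∫⁻ y, (‖f₁ y‖ₑ + ‖g₁ y‖ₑ) ^ p) ^ (1 / p) ≤ sobolevNorm Ω (ENNReal.ofReal p) f := by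
    rw [sobolevNorm, ← hf₁n, ← hg₁n, eLpNorm_ofReal_eq_lintegral_rpow hp0,
      eLpNorm_ofReal_eq_lintegral_rpow hp0]
    exact ENNReal.lintegral_Lp_add_le hf₁m.enorm.aemeasurable hg₁m.enorm.aemeasurable hp.le
  have hSfin : sobolevNorm Ω (ENNReal.ofReal p) f ≠ ⊤ :=
    ENNReal.add_ne_top.2 ⟨hf.1.2.ne, hgradp.2.ne⟩
  have hMq : (∫⁻ x in Ω, M x ^ q) ^ (1 / q) ≤
      (D : ℝ≥0∞) ^ (1 / q) * sobolevNorm Ω (ENNReal.ofReal p) f := by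
    calc _ ≤ (D * (∫⁻ y, (‖f₁ y‖ₑ + ‖g₁ y‖ₑ) ^ p) ^ (q / p)) ^ (1 / q) :=
          ENNReal.rpow_le_rpow ((setLIntegral_le_lintegral _ _).trans (hD R _ hum hut))
            (by positivity)
      _ = (D : ℝ≥0∞) ^ (1 / q) * (∫⁻ y, (‖f₁ y‖ₑ + ‖g₁ y‖ₑ) ^ p) ^ (1 / p) := by
          rw [ENNReal.mul_rpow_of_nonneg _ _ (by positivity), ← ENNReal.rpow_mul]
          congr 2
          field_simp
      _ ≤ _ := by gcongr
  have hDtop : (D : ℝ≥0∞) ^ (1 / q) ≠ ⊤ :=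
    ENNReal.rpow_ne_top_of_nonneg (by positivity) ENNReal.coe_ne_top
  have hMqfin : ∫⁻ x in Ω, M x ^ q ≠ ⊤ := fun htop => by
    rw [htop, ENNReal.top_rpow_of_pos (by positivity)] at hMq
    exact ENNReal.mul_ne_top hDtop hSfin (top_le_iff.1 hMq)
  have hM1 := lintegral_ne_top_of_lintegral_rpow_ne_top hq1 hMqfin
  rw [localFracMaximal_congr_ae γ β hf₁]
  obtain ⟨hFm, v, hvm, hv, hvb⟩ := hwg.exists_hasWeakGradient_localFracMaximal hΩ hf₁m hf₁t hg₁m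
    hg₁t γ β hR hw hC0 hwb hM1
  have hFM : ∀ x, localFracMaximal γ β Ω f₁ x ≤ ENNReal.ofReal C * M x := fun x =>
    localFracMaximal_le_fracMaximal γ β hR hC0 (fun r h0 h1 => (hwb r h0 h1).2)
      (fun y => le_self_add) x
  have hFfin : ∀ᵐ x ∂volume.restrict Ω, localFracMaximal γ β Ω f₁ x < ⊤ := by
    filter_upwards [ae_lt_top (measurable_fracMaximal volume (β - 1) R _) hM1] with x hx
    exact (hFM x).trans_lt (ENNReal.mul_lt_top ENNReal.ofReal_lt_top hx)
  have hFn := eLpNorm_le_const_mul_lintegral_rpow (μ := volume.restrict Ω) hq0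
    (u := fun x => (localFracMaximal γ β Ω f₁ x).toReal) (M := M) ENNReal.ofReal_ne_top
    (.of_forall fun x => by
      rw [Real.enorm_of_nonneg ENNReal.toReal_nonneg]
      exact ENNReal.ofReal_toReal_le.trans (hFM x))
  have hvn := eLpNorm_le_const_mul_lintegral_rpow (μ := volume.restrict Ω) hq0
    (u := v) (M := M) (b := n * ENNReal.ofReal (2 * C)) (by finiteness)
    (hvb.mono fun x hx => by rwa [mul_assoc])
  have hfinal : eLpNorm (fun x => (localFracMaximal γ β Ω f₁ x).toReal) (ENNReal.ofReal q)
      (volume.restrict Ω) + eLpNorm v (ENNReal.ofReal q) (volume.restrict Ω) ≤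
        A * sobolevNorm Ω (ENNReal.ofReal p) f := by
    refine (add_le_add hFn hvn).trans ?_
    rw [← add_mul, hA, ENNReal.coe_mul, ENNReal.coe_add, ENNReal.coe_mul, mul_assoc,
      ENNReal.coe_rpow_of_nonneg _ (by positivity)]
    exact mul_le_mul_right hMq _
  have hlt := hfinal.trans_lt (ENNReal.mul_lt_top ENNReal.coe_lt_top hSfin.lt_top)
  have hmem : MemSobolev Ω (ENNReal.ofReal q) (fun x => (localFracMaximal γ β Ω f₁ x).toReal) :=
    ⟨⟨hFm.ennreal_toReal.aestronglyMeasurable, le_self_add.trans_lt hlt⟩, v, hv,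
      hvm.aestronglyMeasurable, le_add_self.trans_lt hlt⟩
  refine ⟨hFfin, hmem, ?_⟩
  -- The gradient selected in `weakGradient` agrees almost everywhere on `Ω` with the dominated
  -- gradient `v`.
  rw [sobolevNorm, eLpNorm_congr_ae ((hmem.hasWeakGradient_weakGradient hΩ).1.ae_eq hΩ hv)]
  refine hfinal.trans ?_
  gcongr
  exact le_self_add
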